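/- Let $d\ge 2$, $0<r_0<r<1$, let $S^d\subset\mathbb R^{d+1}$ be the unit sphere with (unnormalized) surface measure $\mu_d$ and area $\omega_d=2\pi^{(d+1)/2}/\Gamma(\frac{d+1}{2})$; write $\mu_d$ also for the surface measure on $rS^d$. For $l\ge 0$ let $Z(d,l)$ be the dimension of the space of spherical harmonics of degree $l$ (restrictions to $S^d$ of homogeneous harmonic polynomials of degree $l$), and let $\{Y_{l,k}: l\ge 0,\ 1\le k\le Z(d,l)\}$ be a real orthonormal basis of $L^2(S^d,\mu_d)$ such that, for each $l$, the $Y_{l,k}$ span the spherical harmonics of degree $l$. For $f:\mathbb R^{d+1}\to\mathbb R$ put $f_r(\eta)=f(r\eta)$, $\eta\in S^d$, and $\hat f_r(l,k)=\int_{S^d} f_rY_{l,k}\,d\mu_d$. Let $D(f)$ denote the integrable function on $rS^d$ (if there is one; it is unique up to null sets) such that $\eta\mapsto D(f)(r\eta)$ has the spherical expansion $$\sum_{l=0}^\infty\sum_{k=1}^{Z(d,l)}\frac{2l+d-1}{(d-1)\omega_d}\,\hat f_r(l,k)\,Y_{l,k}.$$ For a finite signed Borel measure $\sigma$ put $U^\sigma(x)=\int_{S^d}\|x-y\|^{-(d-1)}\,d\sigma(y)$.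 Let $f:\mathbb R^{d+1}\to\mathbb R$ be harmonic on $\{\|x\|>r\}$, continuous on $\{\|x\|\ge r\}$, with $f(x)\to 0$ as $\|x\|\to\infty$, such that $D(f)$ exists and $\|D(f)\|_{L_\infty(rS^d)}<\infty$, and suppose that $$f_r(\eta)=\sum_{l=0}^\infty\sum_{k=1}^{Z(d,l)}\hat f_r(l,k)Y_{l,k}(\eta)\qquad\text{for every }\eta\in S^d.$$ Let $t_{1,n},\dots,t_{n,n}$, $n\ge1$, be distinct points of $S^d$, let $a_{1,n},\dots,a_{n,n}$ be real weights, $\nu_n=\sum_{k=1}^n a_{k,n}\delta_{t_{k,n}}$, and let $\mu$ be a finite Borel measure on $\mathbb R^{d+1}$ with support in $S^d$. Let $1\le p,p'\le\infty$ with $\frac1p+\frac1{p'}=1$. Then $$\left|\int_{S^d}f\,d\mu-\sum_{k=1}^n a_{k,n}f(t_{k,n})\right|\le\frac1{r_0}\,\|D(f)\|_{L_p(rS^d)}\,\|U^{\mu-\nu_n}\|_{L_{p'}(rS^d)},$$ where the norms are taken with respect to $\mu_d$ on $rS^d$. -/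

import Mathlib

open MeasureTheory Metric Filter Topology
open scoped ENNReal

namespace SphereQuadrature

/-- The ambient Euclidean space `ℝ^{d+1}`. -/
abbrev E (d : ℕ) : Type := EuclideanSpace ℝ (Fin (d + 1))

/-- The unit sphere `S^d` in `ℝ^{d+1}`, as a type. -/
abbrev S (d : ℕ) : Type := sphere (0 : E d) 1

/-- The surface measure on `S^d` (not normalized). -/
noncomputable def surf (d : ℕ) : Measure (S d) :=
  (volume : Measure (E d)).toSphere

/-- The surface measure on the sphere `r S^d`, `0 < r`, as a measure on `ℝ^{d+1}`: the image of
`r ^ d` times the surface measure of `S^d` under `η ↦ r η`. -/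
noncomputable def surfR (d : ℕ) (r : ℝ) : Measure (E d) :=
  ENNReal.ofReal (r ^ d) • (surf d).map (fun η : S d => r • (η : E d))

/-- The surface area of `S^d`. -/
noncomputable def area (d : ℕ) : ℝ :=
  2 * Real.pi ^ (((d : ℝ) + 1) / 2) / Real.Gamma (((d : ℝ) + 1) / 2)

/-- The Laplacian on real polynomials in `d + 1` variables. -/
noncomputable def polyLaplacian (d : ℕ) :
    MvPolynomial (Fin (d + 1)) ℝ →ₗ[ℝ] MvPolynomial (Fin (d + 1)) ℝ :=
  ∑ i, (MvPolynomial.pderiv i).toLinearMap ∘ₗ (MvPolynomial.pderiv i).toLinearMap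

/-- Restriction of a polynomial to `S^d`, as a function. -/
noncomputable def restrictToSphere (d : ℕ) :
    MvPolynomial (Fin (d + 1)) ℝ →ₗ[ℝ] (S d → ℝ) :=
  LinearMap.pi fun η => (MvPolynomial.aeval fun i => (η : E d) i).toLinearMap

/-- The spherical harmonics of degree `l`: the restrictions to `S^d` of the homogeneous harmonic
polynomials of degree `l`. -/
noncomputable def sphericalHarmonics (d l : ℕ) : Submodule ℝ (S d → ℝ) :=
  (MvPolynomial.homogeneousSubmodule (Fin (d + 1)) ℝ l ⊓ LinearMap.ker (polyLaplacian d)).map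
    (restrictToSphere d)

/-- The dimension of the space of spherical harmonics of degree `l`. -/
noncomputable def Z (d l : ℕ) : ℕ := Module.finrank ℝ (sphericalHarmonics d l)

/-- `Y l k`, `k < Z d l`, is a real orthonormal basis of `L²(S^d)` (with respect to surface
measure) consisting of spherical harmonics: for each `l` the `Y l k` are a basis of the spherical
harmonics of degree `l`, and the whole family is orthonormal. -/
structure IsHarmonicBasis (d : ℕ) (Y : (l : ℕ) → Fin (Z d l) → S d → ℝ) : Prop where
  span_eq : ∀ l, Submodule.span ℝ (Set.range (Y l)) = sphericalHarmonics d l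
  norm_one : ∀ l k, ∫ η, Y l k η * Y l k η ∂(surf d) = 1
  orthogonal : ∀ l k l' k', (⟨l, k⟩ : (l : ℕ) × Fin (Z d l)) ≠ ⟨l', k'⟩ →
    ∫ η, Y l k η * Y l' k' η ∂(surf d) = 0

/-- The coefficient `\hat{f_r}(l,k) = ∫_{S^d} f(r η) Y_{l,k}(η) dη`. -/
noncomputable def coeff {d : ℕ} (Y : (l : ℕ) → Fin (Z d l) → S d → ℝ) (r : ℝ) (f : E d → ℝ)
    (l : ℕ) (k : Fin (Z d l)) : ℝ :=
  ∫ η, f (r • (η : E d)) * Y l k η ∂(surf d)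

/-- `Df` is the function `D(f)` on `r S^d`: it is integrable there and its spherical expansion
is the formal series `∑_{l,k} (2l+d-1) / ((d-1) ω_d) \hat{f_r}(l,k) Y_{l,k}` (with `D(f)(r η)` the
value of this expansion at `η ∈ S^d`). This determines `Df` almost everywhere on `r S^d`; the
values of `Df` off `r S^d` are irrelevant. -/
structure IsD {d : ℕ} (Y : (l : ℕ) → Fin (Z d l) → S d → ℝ) (r : ℝ) (f Df : E d → ℝ) :
    Prop where
  integrable : Integrable Df (surfR d r)
  coeff_eq : ∀ l k, coeff Y r Df l k =
    (2 * (l : ℝ) + (d : ℝ) - 1) / (((d : ℝ) - 1) * area d) * coeff Y r f l k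

/-- The class `𝓕_r`: `f` is harmonic on `‖x‖ > r`, continuous on `‖x‖ ≥ r`, vanishes at infinity,
and `D(f)` is an essentially bounded function on `r S^d`. -/
structure MemF {d : ℕ} (Y : (l : ℕ) → Fin (Z d l) → S d → ℝ) (r : ℝ) (f : E d → ℝ) : Prop where
  harmonic : InnerProductSpace.HarmonicOnNhd f {x | r < ‖x‖}
  continuousOn : ContinuousOn f {x | r ≤ ‖x‖}
  vanishes : Tendsto f (cocompact (E d)) (𝓝 0)
  bounded : ∃ Df, IsD Y r f Df ∧ eLpNorm Df ∞ (surfR d r) < ∞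

/-- `f_r` is everywhere on `S^d` the sum of its spherical expansion `∑_l ∑_k`. -/
def IsSumOfExpansion {d : ℕ} (Y : (l : ℕ) → Fin (Z d l) → S d → ℝ) (r : ℝ) (f : E d → ℝ) :
    Prop :=
  ∀ η : S d, Tendsto (fun L => ∑ l ∈ Finset.range L, ∑ k, coeff Y r f l k * Y l k η) atTop
    (𝓝 (f (r • (η : E d))))

/-- The Newtonian potential `U^σ(x) = ∫_{S^d} ‖x - y‖^{-(d-1)} dσ(y)` of a signed measure. -/
noncomputable def potential {d : ℕ} (σ : SignedMeasure (E d)) (x : E d) : ℝ :=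
  ∫ᵛ y in sphere (0 : E d) 1, 1 / ‖x - y‖ ^ (d - 1) ∂<•σ

/-- The weighted point measure `ν = ∑_k a_k δ_{t_k}`. -/
noncomputable def pointMeasure {d n : ℕ} (a : Fin n → ℝ) (t : Fin n → S d) :
    SignedMeasure (E d) :=
  ∑ k, a k • (Measure.dirac (t k : E d)).toSignedMeasure

end SphereQuadrature

/-! On the unit sphere, `f` is `1/r` times the Newtonian potential of `D(f)` carried by the sphere
of radius `r` (`MemF.eq_integral_surfR`). Given this, the quadrature error is, by Fubini, `1/r`
times the integral of `D(f)` against `U^{μ-ν}`; Hölder's inequality and `1/r ≤ 1/r₀` finish the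
proof.

The representation compares two kernels. With `λ = (d-1)/2`, `0 ≤ s < 1` and `t = ⟪η, y⟫`, the
Newtonian kernel `‖sη - y‖^{-(d-1)}` is `∑ C_l^λ(t) s^l`, and `(d-1)(1-s²)/‖sη - y‖^{d+1}` is `∑
(2l+d-1) C_l^λ(t) s^l`. The multiplier defining `D(f)` is the ratio of these coefficients divided by
`(d-1) ω_d`, so the potential of `D(f)` is the Poisson integral of `f_r`
(`IsHarmonicBasis.integral_newton_eq_poisson`). No addition theorem is needed, only that `η ↦
C_l^λ(⟪η, y⟫)` is a spherical harmonic of degree `l`.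

It remains to see that `f` is the exterior Poisson integral of its boundary values
(`IsHarmonicBasis.eq_poissonIntegral`). That integral is harmonic, has boundary values `f_r` and
decays at infinity, so a maximum principle identifies it with `f`. -/

namespace SphereQuadrature

/-! ### Gegenbauer polynomials and their generating functions -/

/-- The Gegenbauer polynomials `C_n^λ` with `2 λ = d - 1`, as functions, by their three-term
recurrence. -/
noncomputable def gegenbauer (d : ℕ) (t : ℝ) : ℕ → ℝ
  | 0 => 1
  | 1 => ((d : ℝ) - 1) * t
  | n + 2 => ((2 * (n : ℝ) + d + 1) * t * gegenbauer d t (n + 1)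
      - ((n : ℝ) + d - 1) * gegenbauer d t n) / ((n : ℝ) + 2)

lemma gegenbauer_recurrence (d : ℕ) (t : ℝ) (n : ℕ) :
    ((n : ℝ) + 2) * gegenbauer d t (n + 2) =
      (2 * (n : ℝ) + d + 1) * t * gegenbauer d t (n + 1)
        - ((n : ℝ) + d - 1) * gegenbauer d t n := by
  have : (n : ℝ) + 2 ≠ 0 := by positivity
  rw [gegenbauer]
  field_simp

/-- The coefficients of the binomial series `(1 - x)^(-a)`. -/
noncomputable def negBinomialCoeff (a : ℂ) (n : ℕ) : ℂ := Ring.choose (a + n - 1) n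

lemma negBinomialCoeff_eq (a : ℂ) (n : ℕ) : negBinomialCoeff a n = Ring.multichoose a n := by
  rw [negBinomialCoeff, Ring.choose]
  congr 1
  ring

lemma negBinomialCoeff_zero (a : ℂ) : negBinomialCoeff a 0 = 1 := by
  simp [negBinomialCoeff_eq]

lemma negBinomialCoeff_succ (a : ℂ) (n : ℕ) :
    negBinomialCoeff a (n + 1) * (n + 1) = (a + n) * negBinomialCoeff a n := by
  have h1 := Ring.factorial_nsmul_multichoose_eq_ascPochhammer a n
  have h2 := Ring.factorial_nsmul_multichoose_eq_ascPochhammer a (n + 1)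
  rw [Polynomial.ascPochhammer_smeval_eq_eval] at h1 h2
  rw [ascPochhammer_succ_right, Polynomial.eval_mul, ← h1] at h2
  have h3 : (n.factorial : ℂ) ≠ 0 := by exact_mod_cast n.factorial_ne_zero
  simp only [nsmul_eq_mul, Nat.factorial_succ, Nat.cast_mul, Polynomial.eval_add,
    Polynomial.eval_X, Polynomial.eval_natCast, Nat.cast_add, Nat.cast_one] at h2
  rw [negBinomialCoeff_eq, negBinomialCoeff_eq]
  apply mul_left_cancel₀ h3
  linear_combination h2

lemma hasSum_negBinomialCoeff (a : ℂ) {x : ℂ} (hx : ‖x‖ < 1) :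
    HasSum (fun n => negBinomialCoeff a n * x ^ n) (1 / (1 - x) ^ a) ∧
      Summable fun n => ‖negBinomialCoeff a n * x ^ n‖ := by
  have h := Complex.one_div_one_sub_cpow_hasFPowerSeriesOnBall_zero a
  have hx' : x ∈ Metric.eball (0 : ℂ) 1 := by
    rw [Metric.mem_eball, edist_zero_right, enorm_eq_nnnorm]
    exact_mod_cast hx
  constructor
  · simpa [FormalMultilinearSeries.ofScalars_apply_eq, negBinomialCoeff, mul_comm] using h.hasSum hx'
  · have := FormalMultilinearSeries.summable_norm_apply _ (Metric.eball_subset_eball h.r_le hx')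
    simpa [FormalMultilinearSeries.ofScalars_apply_eq, negBinomialCoeff, mul_comm] using this

/-- The power series of `(1 - z x)^(-a)`. -/
noncomputable def negBinomialSeries (a z : ℂ) : PowerSeries ℂ :=
  PowerSeries.mk fun n => negBinomialCoeff a n * z ^ n

/-- The first-order differential equation of `(1 - zX)^(-a)`; multiplying two of these yields the
Gegenbauer recurrence. -/
lemma derivative_negBinomialSeries (a z : ℂ) :
    (1 - PowerSeries.C z * PowerSeries.X) *
      PowerSeries.derivative ℂ (negBinomialSeries a z) =
        PowerSeries.C (a * z) * negBinomialSeries a z := by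
  ext n
  rw [sub_mul, one_mul, mul_assoc, map_sub, PowerSeries.coeff_C_mul, PowerSeries.coeff_C_mul,
    PowerSeries.coeff_derivative]
  cases n with
  | zero =>
    have := negBinomialCoeff_succ a 0
    simp [negBinomialSeries] at this ⊢
    linear_combination z * this
  | succ n =>
    have := negBinomialCoeff_succ a (n + 1)
    rw [PowerSeries.coeff_succ_X_mul, PowerSeries.coeff_derivative]
    simp only [negBinomialSeries, PowerSeries.coeff_mk]
    push_cast at this ⊢
    linear_combination z ^ (n + 2) * this

/-- For `w` the conjugate of `z`, `zw = 1` and `z + w = 2 Re z`, so `(1 - zX)(1 - wX) = 1 - 2tX +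
X²` with `t = Re z`. The product `G` of the two series therefore satisfies `(1 - 2tX + X²) G' =
(d-1)(t - X) G`, and comparing coefficients gives the three-term recurrence. -/
lemma coeff_negBinomialSeries_mul (d : ℕ) {z : ℂ} (hz : ‖z‖ = 1) (n : ℕ) :
    PowerSeries.coeff n (negBinomialSeries (((d : ℂ) - 1) / 2) z *
      negBinomialSeries (((d : ℂ) - 1) / 2) (starRingEnd ℂ z)) = (gegenbauer d z.re n : ℂ) := by
  set a : ℂ := ((d : ℂ) - 1) / 2 with ha
  set w : ℂ := starRingEnd ℂ z
  set A := negBinomialSeries a z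
  set B := negBinomialSeries a w
  have hzw : z * w = 1 := by rw [Complex.mul_conj']; simp [hz]
  have hre : z + w = 2 * (z.re : ℂ) := by rw [Complex.add_conj]; push_cast; ring
  have hX : (PowerSeries.C z * PowerSeries.C w : PowerSeries ℂ) = 1 := by
    rw [← map_mul, hzw, map_one]
  have hode : (1 - PowerSeries.C (2 * (z.re : ℂ)) * PowerSeries.X + PowerSeries.X ^ 2) *
      PowerSeries.derivative ℂ (A * B) =
        PowerSeries.C ((d : ℂ) - 1) * (PowerSeries.C (z.re : ℂ) - PowerSeries.X) * (A * B) := by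
    have hA : _ = PowerSeries.C (a * z) * A := derivative_negBinomialSeries a z
    have hB : _ = PowerSeries.C (a * w) * B := derivative_negBinomialSeries a w
    have hD : PowerSeries.derivative ℂ (A * B) =
        A * PowerSeries.derivative ℂ B + B * PowerSeries.derivative ℂ A := by
      rw [Derivation.leibniz, smul_eq_mul, smul_eq_mul]
    have hd : (d : ℂ) - 1 = 2 * a := by rw [ha]; ring
    have ht : (z.re : ℂ) = (z + w) / 2 := by rw [hre]; ring
    rw [hD, hd, ← hre]
    have h2 : (PowerSeries.C (2 * a) * PowerSeries.C (z.re : ℂ) : PowerSeries ℂ) =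
        PowerSeries.C a * (PowerSeries.C z + PowerSeries.C w) := by
      rw [ht, ← map_add, ← map_mul, ← map_mul]; congr 1; ring
    have h3 : (PowerSeries.C (2 * a) : PowerSeries ℂ) = 2 * PowerSeries.C a := by
      rw [map_mul]; rfl
    rw [mul_sub, h2, h3]
    simp only [map_mul, map_add] at hA hB ⊢
    linear_combination (1 - PowerSeries.C z * PowerSeries.X) * A * hB
      + (1 - PowerSeries.C w * PowerSeries.X) * B * hA
      - PowerSeries.X ^ 2 * (A * PowerSeries.derivative ℂ B + B * PowerSeries.derivative ℂ A) * hX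
      - 2 * PowerSeries.X * PowerSeries.C a * A * B * hX
  set G := A * B
  have h0 : PowerSeries.coeff 0 G = 1 := by
    simp [G, A, B, negBinomialSeries, negBinomialCoeff_zero]
  have hd2 : 2 * a = (d : ℂ) - 1 := by rw [ha]; ring
  have hc : ∀ k, PowerSeries.coeff k
      (PowerSeries.derivative ℂ G - PowerSeries.C (2 * (z.re : ℂ)) *
        (PowerSeries.X * PowerSeries.derivative ℂ G)
        + PowerSeries.X * (PowerSeries.X * PowerSeries.derivative ℂ G)) =
      PowerSeries.coeff k (PowerSeries.C (2 * a) *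
        (PowerSeries.C (z.re : ℂ) * G - PowerSeries.X * G)) := by
    intro k
    congr 1
    rw [← hd2] at hode
    linear_combination hode
  have h1 : PowerSeries.coeff 1 G = ((d : ℂ) - 1) * z.re := by
    have := hc 0
    simp only [map_add, map_sub, PowerSeries.coeff_C_mul, PowerSeries.coeff_zero_X_mul,
      PowerSeries.coeff_derivative] at this
    have hG : PowerSeries.constantCoeff G = 1 := by simpa using h0
    simpa [hG, hd2] using this
  have hrec : ∀ k : ℕ, ((k : ℂ) + 2) * PowerSeries.coeff (k + 2) G =
      (2 * (k : ℂ) + d + 1) * z.re * PowerSeries.coeff (k + 1) G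
        - ((k : ℂ) + d - 1) * PowerSeries.coeff k G := by
    intro k
    have := hc (k + 1)
    simp only [map_add, map_sub, PowerSeries.coeff_C_mul, PowerSeries.coeff_succ_X_mul,
      PowerSeries.coeff_derivative] at this
    rw [hd2] at this
    cases k with
    | zero =>
      simp only [PowerSeries.coeff_zero_X_mul] at this
      push_cast at this ⊢
      linear_combination this
    | succ k =>
      simp only [PowerSeries.coeff_succ_X_mul, PowerSeries.coeff_derivative] at this
      push_cast at this ⊢
      linear_combination this
  induction n using Nat.strong_induction_on with
  | _ n ih =>
    match n, ih with
    | 0, _ => simpa [gegenbauer] using h0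
    | 1, _ => simpa [gegenbauer] using h1
    | k + 2, ih =>
      have hk : ((k : ℂ) + 2) ≠ 0 := by exact_mod_cast (by positivity : ((k : ℝ) + 2) ≠ 0)
      apply mul_left_cancel₀ hk
      rw [hrec, ih (k + 1) (by omega), ih k (by omega)]
      have := gegenbauer_recurrence d z.re k
      exact_mod_cast this.symm

lemma exists_unit_re {t : ℝ} (ht : |t| ≤ 1) : ∃ z : ℂ, ‖z‖ = 1 ∧ z.re = t := by
  refine ⟨⟨t, √(1 - t ^ 2)⟩, ?_, rfl⟩
  have h : 0 ≤ 1 - t ^ 2 := by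
    have := (sq_le_one_iff_abs_le_one t).2 ht
    linarith
  rw [Complex.norm_def, Complex.normSq_mk, Real.mul_self_sqrt h]
  simp [← sq]

lemma gegenbauer_eq_sum (d : ℕ) {z : ℂ} (hz : ‖z‖ = 1) (n : ℕ) :
    (gegenbauer d z.re n : ℂ) = ∑ kl ∈ Finset.HasAntidiagonal.antidiagonal n,
      negBinomialCoeff (((d : ℂ) - 1) / 2) kl.1 * z ^ kl.1 *
        (negBinomialCoeff (((d : ℂ) - 1) / 2) kl.2 * (starRingEnd ℂ z) ^ kl.2) := by
  rw [← coeff_negBinomialSeries_mul d hz, PowerSeries.coeff_mul]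
  simp [negBinomialSeries]

/-- Generating function of the Gegenbauer polynomials; `q` is the distance of `s ξ` and `η` for
unit vectors `ξ`, `η` at angle `arccos t`. -/
theorem hasSum_gegenbauer {d : ℕ} {t s q : ℝ} (ht : |t| ≤ 1) (hs : |s| < 1) (hq : 0 < q)
    (hd : 1 ≤ d) (hqs : q ^ 2 = 1 - 2 * t * s + s ^ 2) :
    HasSum (fun n => gegenbauer d t n * s ^ n) (1 / q ^ (d - 1)) := by
  obtain ⟨z, hz, rfl⟩ := exists_unit_re ht
  set a : ℂ := ((d : ℂ) - 1) / 2 with ha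
  have hn : ‖z * s‖ < 1 := by simpa [hz] using hs
  have hn' : ‖(starRingEnd ℂ z) * s‖ < 1 := by simpa [hz] using hs
  obtain ⟨hA, hAs⟩ := hasSum_negBinomialCoeff a hn
  obtain ⟨hB, hBs⟩ := hasSum_negBinomialCoeff a hn'
  have hprod := tsum_mul_tsum_eq_tsum_sum_antidiagonal_of_summable_norm hAs hBs
  have hsum := (summable_norm_sum_mul_antidiagonal_of_summable_norm hAs hBs).of_norm.hasSum
  rw [← hprod, hA.tsum_eq, hB.tsum_eq] at hsum
  have har : a = (((d : ℝ) - 1) / 2 : ℝ) := by rw [ha]; push_cast; rfl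
  have hqn : ‖1 - z * s‖ = q := by
    rw [← sq_eq_sq₀ (norm_nonneg _) hq.le, hqs, Complex.sq_norm, Complex.normSq_apply]
    have : z.re * z.re + z.im * z.im = 1 := by
      rw [← Complex.normSq_apply, ← Complex.sq_norm, hz]; norm_num
    simp
    linear_combination s ^ 2 * this
  have hval : 1 / (1 - z * s) ^ a * (1 / (1 - (starRingEnd ℂ z) * s) ^ a) =
      ((1 / q ^ (d - 1) : ℝ) : ℂ) := by
    -- Off the branch cut the power commutes with conjugation, so the two factors are conjugate and
    -- their product is `‖1 - zs‖^(-2a) = q^(-(d-1))`.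
    have hne : (1 - z * s).arg ≠ Real.pi := by
      apply Complex.slitPlane_arg_ne_pi
      rw [sub_eq_add_neg]
      apply Complex.mem_slitPlane_of_norm_lt_one
      simpa using hn
    have hconj : (1 - (starRingEnd ℂ z) * s) ^ a = starRingEnd ℂ ((1 - z * s) ^ a) := by
      have h1 : 1 - (starRingEnd ℂ z) * s = starRingEnd ℂ (1 - z * s) := by simp
      have h2 : a = starRingEnd ℂ a := by rw [har, Complex.conj_ofReal]
      rw [h1, Complex.conj_cpow _ _ hne, ← h2]
    rw [hconj, div_mul_div_comm, one_mul, Complex.mul_conj', har, Complex.norm_cpow_real, hqn]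
    have : (q ^ (((d : ℝ) - 1) / 2)) ^ 2 = q ^ (d - 1) := by
      rw [← Real.rpow_natCast, ← Real.rpow_mul hq.le, ← Real.rpow_natCast]
      congr 1
      push_cast [hd]
      ring
    rw [← this]
    push_cast
    rfl
  rw [hval] at hsum
  rw [← Complex.hasSum_ofReal]
  refine hsum.congr_fun fun n => ?_
  push_cast
  rw [gegenbauer_eq_sum d hz, Finset.sum_mul]
  refine Finset.sum_congr rfl fun kl hkl => ?_
  rw [← Finset.HasAntidiagonal.mem_antidiagonal.1 hkl, pow_add, mul_pow, mul_pow]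
  ring

/-- Since `‖z‖ = 1`, taking norms in `gegenbauer_eq_sum` removes all dependence on `t`; what remains
is a term of the Cauchy square of an absolutely convergent series. -/
lemma exists_gegenbauer_bound (d : ℕ) {ρ : ℝ} (h0 : 0 ≤ ρ) (h1 : ρ < 1) :
    ∃ C, ∀ t, |t| ≤ 1 → ∀ n, |gegenbauer d t n| * ρ ^ n ≤ C := by
  set a : ℂ := ((d : ℂ) - 1) / 2
  have hn : ‖(ρ : ℂ)‖ < 1 := by simpa [abs_of_nonneg h0] using h1
  have hA := (hasSum_negBinomialCoeff a hn).2
  have hs : Summable fun n => ‖(‖negBinomialCoeff a n * (ρ : ℂ) ^ n‖ : ℝ)‖ := by simpa using hA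
  have hS := summable_norm_sum_mul_antidiagonal_of_summable_norm hs hs
  refine ⟨∑' n, _, fun t ht n => le_trans ?_ (hS.le_tsum n fun _ _ => norm_nonneg _)⟩
  obtain ⟨z, hz, rfl⟩ := exists_unit_re ht
  rw [← Real.norm_eq_abs, ← Complex.norm_real, gegenbauer_eq_sum d hz]
  rw [Real.norm_of_nonneg (Finset.sum_nonneg fun _ _ => by positivity)]
  refine (mul_le_mul_of_nonneg_right (norm_sum_le _ _) (by positivity)).trans ?_
  rw [Finset.sum_mul]
  refine Finset.sum_le_sum fun kl hkl => le_of_eq ?_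
  rw [← Finset.HasAntidiagonal.mem_antidiagonal.1 hkl, pow_add]
  simp [hz, abs_of_nonneg h0, a]
  ring

/-- Uniform summability of the Gegenbauer series, together with a linear factor. -/
lemma exists_gegenbauer_majorant (d : ℕ) {s : ℝ} (h0 : 0 ≤ s) (h1 : s < 1) :
    ∃ b : ℕ → ℝ, Summable b ∧ ∀ t, |t| ≤ 1 → ∀ n : ℕ,
      (2 * (n : ℝ) + d + 1) * (|gegenbauer d t n| * s ^ n) ≤ b n := by
  -- The gap between `s` and `ρ` leaves a geometric factor that absorbs the linear weight. The
  -- weight `2n+d+1` dominates both `1` and `2n+d-1`, so one majorant serves the Newtonian and the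
  -- Poisson series.
  obtain ⟨ρ, hsρ, hρ1⟩ := exists_between h1
  have hρ0 : 0 < ρ := h0.trans_lt hsρ
  obtain ⟨C, hC⟩ := exists_gegenbauer_bound d hρ0.le hρ1
  have hx0 : 0 ≤ s / ρ := by positivity
  have hx1 : s / ρ < 1 := (div_lt_one hρ0).2 hsρ
  have hg := summable_geometric_of_lt_one hx0 hx1
  have hg' : Summable fun n : ℕ => ((n : ℝ) ^ 1 * (s / ρ) ^ n : ℝ) :=
    summable_pow_mul_geometric_of_norm_lt_one 1 (by rwa [Real.norm_of_nonneg hx0])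
  refine ⟨fun n => 2 * C * ((n : ℝ) ^ 1 * (s / ρ) ^ n) + (d + 1) * C * (s / ρ) ^ n,
    (hg'.mul_left _).add (hg.mul_left _), fun t ht n => ?_⟩
  have h2 : |gegenbauer d t n| * s ^ n ≤ C * (s / ρ) ^ n := by
    have : |gegenbauer d t n| * s ^ n = |gegenbauer d t n| * ρ ^ n * (s / ρ) ^ n := by
      rw [div_pow]; field_simp
    rw [this]
    exact mul_le_mul_of_nonneg_right (hC t ht n) (by positivity)
  refine (mul_le_mul_of_nonneg_left h2 (by positivity)).trans (le_of_eq ?_)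
  ring

/-- Instead of differentiating the generating function in `s`, the series is multiplied by `1 - 2ts
+ s²`: after shifting indices, the recurrence turns the result into `(d-1)(1 - s²)` times the
Newtonian series. -/
theorem hasSum_gegenbauer_poisson {d : ℕ} {t s q : ℝ} (ht : |t| ≤ 1) (hs0 : 0 ≤ s) (hs : s < 1)
    (hq : 0 < q) (hd : 1 ≤ d) (hqs : q ^ 2 = 1 - 2 * t * s + s ^ 2) :
    HasSum (fun n : ℕ => (2 * (n : ℝ) + d - 1) * (gegenbauer d t n * s ^ n))
      (((d : ℝ) - 1) * (1 - s ^ 2) / q ^ (d + 1)) := by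
  have hG := hasSum_gegenbauer ht (by rwa [abs_of_nonneg hs0]) hq hd hqs
  set g := fun n => gegenbauer d t n * s ^ n with hg
  set e := fun n : ℕ => (2 * (n : ℝ) + d - 1) * g n with he
  obtain ⟨b, hb, hbb⟩ := exists_gegenbauer_majorant d hs0 hs
  have hes : Summable e := by
    refine Summable.of_norm_bounded hb fun n => le_trans ?_ (hbb t ht n)
    have hd' : (1 : ℝ) ≤ d := by exact_mod_cast hd
    have hn : (0 : ℝ) ≤ n := n.cast_nonneg
    rw [he, hg]
    simp only [norm_mul, norm_pow, Real.norm_eq_abs, abs_of_nonneg hs0]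
    refine mul_le_mul_of_nonneg_right ?_ (by positivity)
    rw [abs_of_nonneg (by linarith)]
    linarith
  have hE := hes.hasSum
  set E := ∑' n, e n
  have h1 := ((hasSum_nat_add_iff' 2).2 hE).sub
    ((((hasSum_nat_add_iff' 1).2 hE).mul_left (2 * t * s)).sub (hE.mul_left (s ^ 2)))
  have h2 := (((hasSum_nat_add_iff' 2).2 hG).sub (hG.mul_left (s ^ 2))).mul_left ((d : ℝ) - 1)
  have h12 := h1.unique (h2.congr_fun fun n => by
    have := gegenbauer_recurrence d t n
    simp only [e, g]
    push_cast
    linear_combination (2 * s ^ (n + 2)) * this)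
  rw [← sub_eq_zero] at h12
  simp [Finset.sum_range_succ, e, g, gegenbauer] at h12
  have hE2 : E * q ^ 2 = ((d : ℝ) - 1) * (1 - s ^ 2) * (1 / q ^ (d - 1)) := by
    rw [hqs]
    simp only [one_div]
    linear_combination h12
  have : ((d : ℝ) - 1) * (1 - s ^ 2) / q ^ (d + 1) = E := by
    have hqp : q ^ (d + 1) = q ^ (d - 1) * q ^ 2 := by rw [← pow_add]; congr 1; omega
    rw [hqp, div_eq_iff (by positivity)]
    have : q ^ (d - 1) ≠ 0 := by positivity
    field_simp at hE2
    linear_combination -hE2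
  rw [this]
  exact hE

/-! ### Solid zonal harmonics -/

open MvPolynomial in
/-- The linear form `x ↦ ⟪x, y⟫` as a polynomial. -/
noncomputable def linForm (d : ℕ) (y : E d) : MvPolynomial (Fin (d + 1)) ℝ :=
  ∑ i, C (y i) * X i

open MvPolynomial in
/-- The polynomial `x ↦ ‖x‖²`. -/
noncomputable def normSqPoly (d : ℕ) : MvPolynomial (Fin (d + 1)) ℝ := ∑ i, X i ^ 2

/-- The derivative of a polynomial in the direction `y`. -/
noncomputable def dirDeriv (d : ℕ) (y : E d) :
    Derivation ℝ (MvPolynomial (Fin (d + 1)) ℝ) (MvPolynomial (Fin (d + 1)) ℝ) :=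
  ∑ i, (y i) • MvPolynomial.pderiv i

open MvPolynomial in
/-- The solid zonal polynomials with pole `y`: homogeneous versions of the Gegenbauer polynomials. -/
noncomputable def zonal (d : ℕ) (y : E d) : ℕ → MvPolynomial (Fin (d + 1)) ℝ
  | 0 => 1
  | 1 => ((d : ℝ) - 1) • linForm d y
  | n + 2 => ((n : ℝ) + 2)⁻¹ •
      ((2 * (n : ℝ) + d + 1) • (linForm d y * zonal d y (n + 1))
        - ((n : ℝ) + d - 1) • (normSqPoly d * zonal d y n))

section Zonal

open MvPolynomial

variable (d : ℕ) (y : E d)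

lemma zonal_recurrence (n : ℕ) :
    ((n : ℝ) + 2) • zonal d y (n + 2) =
      (2 * (n : ℝ) + d + 1) • (linForm d y * zonal d y (n + 1))
        - ((n : ℝ) + d - 1) • (normSqPoly d * zonal d y n) := by
  have : (n : ℝ) + 2 ≠ 0 := by positivity
  rw [zonal, smul_smul, mul_inv_cancel₀ this, one_smul]

lemma isHomogeneous_zonal (n : ℕ) : (zonal d y n).IsHomogeneous n := by
  have hL : (linForm d y).IsHomogeneous 1 :=
    IsHomogeneous.sum _ _ _ fun i _ => by
      simpa using (isHomogeneous_C _ (y i)).mul (isHomogeneous_X ℝ i)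
  have hN : (normSqPoly d).IsHomogeneous 2 :=
    IsHomogeneous.sum _ _ _ fun i _ => by simpa using (isHomogeneous_X ℝ i).pow 2
  induction n using Nat.strong_induction_on with
  | _ n ih =>
    match n, ih with
    | 0, _ => exact isHomogeneous_one _ _
    | 1, _ => simpa [zonal, smul_eq_C_mul, -map_sub] using (isHomogeneous_C _ ((d : ℝ) - 1)).mul hL
    | n + 2, ih =>
      have h1 := hL.mul (ih (n + 1) (by omega))
      have h2 := hN.mul (ih n (by omega))
      rw [show 1 + (n + 1) = n + 2 by omega] at h1
      rw [show 2 + n = n + 2 by omega] at h2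
      have h3 := (((isHomogeneous_C _ (2 * (n : ℝ) + d + 1)).mul h1)).sub
        ((isHomogeneous_C _ ((n : ℝ) + d - 1)).mul h2)
      simpa only [zonal, smul_eq_C_mul, zero_add] using
        (isHomogeneous_C _ (((n : ℝ) + 2)⁻¹)).mul h3

lemma pderiv_linForm (i : Fin (d + 1)) : pderiv i (linForm d y) = C (y i) := by
  simp [linForm, pderiv_X, Pi.single_apply]

lemma pderiv_normSqPoly (i : Fin (d + 1)) : pderiv i (normSqPoly d) = 2 * X i := by
  simp [normSqPoly, Derivation.leibniz_pow, pderiv_X, Pi.single_apply]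

lemma dirDeriv_apply (p : MvPolynomial (Fin (d + 1)) ℝ) :
    dirDeriv d y p = ∑ i, C (y i) * pderiv i p := by
  have h : ∀ s : Finset (Fin (d + 1)), (∑ i ∈ s, y i • pderiv i : Derivation ℝ
      (MvPolynomial (Fin (d + 1)) ℝ) (MvPolynomial (Fin (d + 1)) ℝ)) p =
        ∑ i ∈ s, C (y i) * pderiv i p := by
    intro s
    induction s using Finset.induction_on with
    | empty => simp
    | insert i s hi ih =>
      rw [Finset.sum_insert hi, Finset.sum_insert hi, Derivation.add_apply, ih,
        Derivation.smul_apply, smul_eq_C_mul]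
  exact h _

lemma dirDeriv_linForm (hy : ∑ i, y i ^ 2 = 1) : dirDeriv d y (linForm d y) = 1 := by
  simp only [dirDeriv_apply, pderiv_linForm]
  rw [← C_1, ← hy, map_sum]
  exact Finset.sum_congr rfl fun i _ => by rw [← C_mul, sq]

lemma dirDeriv_normSqPoly : dirDeriv d y (normSqPoly d) = 2 * linForm d y := by
  simp only [dirDeriv_apply, pderiv_normSqPoly, linForm, Finset.mul_sum]
  exact Finset.sum_congr rfl fun i _ => by ring

/-- The Laplacian of `linForm * zonal` contains twice the derivative along the pole. This lowering
relation evaluates it, and is what makes the induction in `polyLaplacian_zonal` close. -/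
lemma dirDeriv_zonal (hy : ∑ i, y i ^ 2 = 1) (n : ℕ) :
    dirDeriv d y (zonal d y (n + 1)) = ((n : ℝ) + d - 1) • zonal d y n := by
  have h0 : dirDeriv d y (zonal d y 0) = 0 := by simp [zonal]
  have hstep : ∀ k : ℕ, ((k : ℝ) + 2) • dirDeriv d y (zonal d y (k + 2)) =
      (2 * (k : ℝ) + d + 1) •
          (linForm d y * dirDeriv d y (zonal d y (k + 1)) + zonal d y (k + 1))
        - ((k : ℝ) + d - 1) •
          (normSqPoly d * dirDeriv d y (zonal d y k) + zonal d y k * (2 * linForm d y)) := by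
    intro k
    have h := congrArg (dirDeriv d y) (zonal_recurrence d y k)
    simpa only [map_sub (dirDeriv d y), Derivation.map_smul, Derivation.leibniz, smul_eq_mul,
        dirDeriv_linForm d y hy, dirDeriv_normSqPoly, mul_one] using h
  have h1 : dirDeriv d y (zonal d y 1) = ((d : ℝ) - 1) • 1 := by
    rw [zonal, Derivation.map_smul, dirDeriv_linForm d y hy]
  induction n using Nat.strong_induction_on with
  | _ n ih =>
    match n, ih with
    | 0, _ => simpa [zonal] using h1
    | 1, _ =>
      have h := hstep 0
      have hne : (2 : ℝ) ≠ 0 := two_ne_zero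
      have hz0 : zonal d y 0 = 1 := by rw [zonal]
      have hz1 : zonal d y 1 = ((d : ℝ) - 1) • linForm d y := by rw [zonal]
      apply smul_right_injective _ hne
      rw [zero_add, zero_add, h0, h1] at h
      simp only [hz0, hz1, Nat.cast_zero, Nat.cast_one, smul_eq_C_mul] at h ⊢
      simp only [map_add, map_sub, map_mul, map_natCast, map_ofNat, C_1, C_0] at h ⊢
      linear_combination h
    | n + 2, ih =>
      have h := hstep (n + 1)
      rw [show n + 1 + 1 = n + 2 from rfl] at h
      have hr := zonal_recurrence d y n
      have hne : ((n : ℝ) + 3) ≠ 0 := by positivity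
      rw [ih (n + 1) (by omega), ih n (by omega)] at h
      apply smul_right_injective _ hne
      simp only [smul_eq_C_mul] at h hr ⊢
      push_cast at h hr ⊢
      simp only [map_add, map_sub, map_mul, map_natCast, map_ofNat, C_1] at h hr ⊢
      linear_combination h - ((n : MvPolynomial (Fin (d + 1)) ℝ) + d) * hr

lemma polyLaplacian_apply (p : MvPolynomial (Fin (d + 1)) ℝ) :
    polyLaplacian d p = ∑ i, pderiv i (pderiv i p) := by
  simp [polyLaplacian]

lemma polyLaplacian_linForm_mul (p : MvPolynomial (Fin (d + 1)) ℝ) :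
    polyLaplacian d (linForm d y * p) = 2 * dirDeriv d y p + linForm d y * polyLaplacian d p := by
  simp only [polyLaplacian_apply, dirDeriv_apply, Finset.mul_sum, ← Finset.sum_add_distrib]
  refine Finset.sum_congr rfl fun i _ => ?_
  simp only [Derivation.leibniz, smul_eq_mul, pderiv_linForm, map_add, pderiv_C, mul_zero]
  ring

lemma polyLaplacian_normSqPoly_mul {n : ℕ} {p : MvPolynomial (Fin (d + 1)) ℝ}
    (hp : p.IsHomogeneous n) :
    polyLaplacian d (normSqPoly d * p) =
      C (2 * ((d : ℝ) + 1) + 4 * n) * p + normSqPoly d * polyLaplacian d p := by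
  have he : ∑ i, X i * pderiv i p = n • p := hp.sum_X_mul_pderiv
  have h : ∀ i, pderiv i (pderiv i (normSqPoly d * p)) =
      2 * p + 4 * (X i * pderiv i p) + normSqPoly d * pderiv i (pderiv i p) := by
    intro i
    have h2 : pderiv i (2 : MvPolynomial (Fin (d + 1)) ℝ) = 0 := by
      rw [← map_ofNat C 2, pderiv_C]
    simp only [Derivation.leibniz, smul_eq_mul, pderiv_normSqPoly, map_add, h2, pderiv_X_self]
    ring
  simp only [polyLaplacian_apply, h, Finset.sum_add_distrib, ← Finset.mul_sum, he]
  simp only [Finset.sum_const, Finset.card_univ, Fintype.card_fin, nsmul_eq_mul, map_add, map_mul,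
    map_natCast, map_ofNat, C_1]
  push_cast
  ring

lemma polyLaplacian_zonal (hy : ∑ i, y i ^ 2 = 1) (n : ℕ) :
    polyLaplacian d (zonal d y n) = 0 := by
  have h0 : polyLaplacian d (zonal d y 0) = 0 := by simp [zonal, polyLaplacian_apply]
  induction n using Nat.strong_induction_on with
  | _ n ih =>
    match n, ih with
    | 0, _ => exact h0
    | 1, _ =>
      rw [zonal, map_smul, polyLaplacian_apply]
      simp [pderiv_linForm]
    | n + 2, ih =>
      have hne : ((n : ℝ) + 2) ≠ 0 := by positivity
      apply smul_right_injective _ hne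
      dsimp only
      -- The two surviving multiples of `zonal d y n` cancel: `2(2n+d+1)(n+d-1)` from the linear
      -- form, `(n+d-1)(2(d+1)+4n)` from `‖x‖²`.
      rw [← map_smul, zonal_recurrence, map_sub, map_smul, map_smul, polyLaplacian_linForm_mul,
        polyLaplacian_normSqPoly_mul d (isHomogeneous_zonal d y n), dirDeriv_zonal d y hy,
        ih (n + 1) (by omega), ih n (by omega)]
      simp only [smul_eq_C_mul, map_add, map_sub, map_mul, map_natCast, map_ofNat, C_1]
      ring

lemma aeval_zonal {x : E d} (hx : ∑ i, x i ^ 2 = 1) (n : ℕ) :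
    aeval (fun i => x i) (zonal d y n) = gegenbauer d (inner ℝ x y) n := by
  have hL : aeval (fun i => x i) (linForm d y) = inner ℝ x y := by
    simp [linForm, PiLp.inner_apply]
  have hN : aeval (fun i => x i) (normSqPoly d) = (1 : ℝ) := by simp [normSqPoly, hx]
  induction n using Nat.strong_induction_on with
  | _ n ih =>
    match n, ih with
    | 0, _ => simp [zonal, gegenbauer]
    | 1, _ => rw [zonal, map_smul, hL, gegenbauer, smul_eq_mul]
    | n + 2, ih =>
      rw [zonal, gegenbauer]
      rw [map_smul, map_sub, map_smul, map_smul, map_mul, map_mul, hL, hN, ih (n + 1) (by omega),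
        ih n (by omega)]
      simp only [smul_eq_mul]
      ring

end Zonal

/-! ### Zonal spherical harmonics and surface area -/

lemma sum_sq_eq_one {d : ℕ} (y : S d) : ∑ i, (y : E d) i ^ 2 = 1 := by
  rw [← EuclideanSpace.real_norm_sq_eq, norm_eq_of_mem_sphere]
  norm_num

lemma gegenbauer_mem_sphericalHarmonics (d : ℕ) (y : S d) (n : ℕ) :
    (fun η : S d => gegenbauer d (inner ℝ (η : E d) (y : E d)) n) ∈ sphericalHarmonics d n := by
  refine Submodule.mem_map.2 ⟨zonal d y n, ⟨isHomogeneous_zonal d y n,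
    polyLaplacian_zonal d y (sum_sq_eq_one y) n⟩, ?_⟩
  ext η
  exact aeval_zonal d y (sum_sq_eq_one η) n

lemma continuous_of_mem_sphericalHarmonics {d l : ℕ} {h : S d → ℝ}
    (hh : h ∈ sphericalHarmonics d l) : Continuous h := by
  obtain ⟨p, -, rfl⟩ := Submodule.mem_map.1 hh
  have : ∀ η : S d, restrictToSphere d p η = MvPolynomial.eval (fun i => (η : E d) i) p := by
    intro η
    simp [restrictToSphere, MvPolynomial.aeval_eq_eval]
  rw [show restrictToSphere d p = _ from funext this]
  exact (MvPolynomial.continuous_eval p).comp (by fun_prop)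

instance (d : ℕ) : IsFiniteMeasure (surf d) := by
  unfold surf
  infer_instance

lemma area_pos (d : ℕ) : 0 < area d := by
  have : 0 < Real.Gamma (((d : ℝ) + 1) / 2) := Real.Gamma_pos_of_pos (by positivity)
  unfold area
  positivity

lemma surf_real_univ (d : ℕ) : (surf d).real Set.univ = area d := by
  have hG : 0 < Real.Gamma (((d : ℝ) + 1) / 2) := Real.Gamma_pos_of_pos (by positivity)
  rw [surf, Measure.toSphere_real_apply_univ, measureReal_def, EuclideanSpace.volume_ball,
    finrank_euclideanSpace, Fintype.card_fin, ENNReal.ofReal_one, one_pow, one_mul, area]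
  push_cast
  rw [Real.Gamma_add_one (by positivity), ENNReal.toReal_ofReal (by positivity)]
  have : √Real.pi ^ (d + 1) = Real.pi ^ (((d : ℝ) + 1) / 2) := by
    rw [Real.sqrt_eq_rpow, ← Real.rpow_natCast, ← Real.rpow_mul Real.pi_pos.le]
    congr 1
    push_cast
    ring
  rw [this]
  field_simp

/-! ### Termwise integration of the Newtonian and Poisson kernels -/

section Kernel

variable {d : ℕ} (y : S d)

lemma abs_inner_le_one (η : S d) : |inner ℝ (η : E d) (y : E d)| ≤ 1 := by
  simpa using abs_real_inner_le_norm (η : E d) (y : E d)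

lemma norm_smul_sub_pos {s : ℝ} (hs : |s| < 1) (η : S d) : 0 < ‖s • (η : E d) - y‖ := by
  rw [norm_pos_iff, sub_ne_zero]
  intro h
  have := congrArg norm h
  rw [norm_smul, norm_eq_of_mem_sphere, norm_eq_of_mem_sphere, Real.norm_eq_abs] at this
  linarith

lemma norm_smul_sub_sq (s : ℝ) (η : S d) :
    ‖s • (η : E d) - y‖ ^ 2 = 1 - 2 * inner ℝ (η : E d) (y : E d) * s + s ^ 2 := by
  rw [norm_sub_sq_real, norm_smul, inner_smul_left, norm_eq_of_mem_sphere, norm_eq_of_mem_sphere]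
  simp
  ring

lemma continuous_gegenbauer_inner (n : ℕ) :
    Continuous fun η : S d => gegenbauer d (inner ℝ (η : E d) (y : E d)) n :=
  continuous_of_mem_sphericalHarmonics (gegenbauer_mem_sphericalHarmonics d y n)

lemma hasSum_integral_mul_of_majorant {g : S d → ℝ} (hg : Integrable g (surf d))
    {c : ℕ → S d → ℝ} {k : S d → ℝ} {b : ℕ → ℝ} (hc : ∀ n, Continuous (c n)) (hb : Summable b)
    (hcb : ∀ n η, |c n η| ≤ b n) (hk : ∀ η, HasSum (fun n => c n η) (k η)) :
    HasSum (fun n => ∫ η, g η * c n η ∂(surf d)) (∫ η, g η * k η ∂(surf d)) := by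
  refine hasSum_integral_of_dominated_convergence (fun n η => |g η| * b n)
    (fun n => hg.aestronglyMeasurable.mul (hc n).aestronglyMeasurable)
    (fun n => ae_of_all _ fun η => ?_) (ae_of_all _ fun η => hb.mul_left _) ?_
    (ae_of_all _ fun η => (hk η).mul_left _)
  · rw [norm_mul, Real.norm_eq_abs, Real.norm_eq_abs]
    exact mul_le_mul_of_nonneg_left (hcb n η) (abs_nonneg _)
  · simp only [tsum_mul_left]
    exact hg.abs.mul_const _

lemma hasSum_integral_newton (hd : 1 ≤ d) {s : ℝ} (h0 : 0 ≤ s) (h1 : s < 1) {g : S d → ℝ}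
    (hg : Integrable g (surf d)) :
    HasSum (fun n => s ^ n * ∫ η, g η * gegenbauer d (inner ℝ (η : E d) (y : E d)) n ∂(surf d))
      (∫ η, g η * (1 / ‖s • (η : E d) - y‖ ^ (d - 1)) ∂(surf d)) := by
  obtain ⟨b, hb, hbb⟩ := exists_gegenbauer_majorant d h0 h1
  have hs : |s| < 1 := by rwa [abs_of_nonneg h0]
  have := hasSum_integral_mul_of_majorant hg
    (fun n => (continuous_gegenbauer_inner y n).mul_const (s ^ n)) hb (fun n η => ?_)
    (fun η => hasSum_gegenbauer (abs_inner_le_one y η) hs (norm_smul_sub_pos y hs η) hd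
      (norm_smul_sub_sq y s η))
  · refine this.congr_fun fun n => ?_
    rw [← integral_const_mul]
    exact integral_congr_ae (ae_of_all _ fun η => by ring)
  · refine le_trans ?_ (hbb _ (abs_inner_le_one y η) n)
    rw [abs_mul, abs_pow, abs_of_nonneg h0]
    have : (0 : ℝ) ≤ n := n.cast_nonneg
    have : (0 : ℝ) ≤ d := d.cast_nonneg
    exact le_mul_of_one_le_left (by positivity) (by linarith)

lemma hasSum_integral_poisson (hd : 1 ≤ d) {s : ℝ} (h0 : 0 ≤ s) (h1 : s < 1) {g : S d → ℝ}
    (hg : Integrable g (surf d)) :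
    HasSum (fun n : ℕ => (2 * (n : ℝ) + d - 1) * s ^ n *
        ∫ η, g η * gegenbauer d (inner ℝ (η : E d) (y : E d)) n ∂(surf d))
      (((d : ℝ) - 1) * ((1 - s ^ 2) * ∫ η, g η * (1 / ‖s • (η : E d) - y‖ ^ (d + 1)) ∂(surf d))) := by
  obtain ⟨b, hb, hbb⟩ := exists_gegenbauer_majorant d h0 h1
  have hs : |s| < 1 := by rwa [abs_of_nonneg h0]
  have := hasSum_integral_mul_of_majorant hg
    (fun n => ((continuous_gegenbauer_inner y n).mul_const (s ^ n)).const_mul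
      (2 * (n : ℝ) + d - 1)) hb (fun n η => ?_)
    (fun η => hasSum_gegenbauer_poisson (abs_inner_le_one y η) h0 h1 (norm_smul_sub_pos y hs η) hd
      (norm_smul_sub_sq y s η))
  · rw [← mul_assoc, ← integral_const_mul]
    convert this using 1
    · ext n
      rw [← integral_const_mul]
      exact integral_congr_ae (ae_of_all _ fun η => by ring)
    · exact integral_congr_ae (ae_of_all _ fun η => by ring)
  · refine le_trans ?_ (hbb _ (abs_inner_le_one y η) n)
    rw [abs_mul, abs_mul, abs_pow, abs_of_nonneg h0]
    have hn : (0 : ℝ) ≤ n := n.cast_nonneg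
    have hd' : (1 : ℝ) ≤ d := by exact_mod_cast hd
    refine mul_le_mul_of_nonneg_right ?_ (by positivity)
    rw [abs_of_nonneg (by linarith)]
    linarith

end Kernel

/-! ### Consequences of the orthonormal basis -/

section Basis

variable {d : ℕ} {Y : (l : ℕ) → Fin (Z d l) → S d → ℝ}

lemma IsHarmonicBasis.continuous (hY : IsHarmonicBasis d Y) (l : ℕ) (k : Fin (Z d l)) :
    Continuous (Y l k) := by
  refine continuous_of_mem_sphericalHarmonics (l := l) ?_
  rw [← hY.span_eq l]
  exact Submodule.subset_span ⟨k, rfl⟩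

lemma integrable_mul_continuous {g h : S d → ℝ} (hg : Integrable g (surf d)) (hh : Continuous h) :
    Integrable (fun η => g η * h η) (surf d) := by
  obtain ⟨C, hC⟩ := isCompact_univ.exists_bound_of_continuousOn hh.continuousOn
  exact hg.mul_bdd (c := C) hh.aestronglyMeasurable (ae_of_all _ fun η => hC η trivial)

/-- A proportionality of the coefficients of degree `l` passes to all spherical harmonics of that
degree. -/
lemma IsHarmonicBasis.integral_mul_eq (hY : IsHarmonicBasis d Y) {F G : S d → ℝ}
    (hF : Integrable F (surf d)) (hG : Integrable G (surf d)) {l : ℕ} {c : ℝ}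
    (h : ∀ k, ∫ η, F η * Y l k η ∂(surf d) = c * ∫ η, G η * Y l k η ∂(surf d))
    {H : S d → ℝ} (hH : H ∈ sphericalHarmonics d l) :
    ∫ η, F η * H η ∂(surf d) = c * ∫ η, G η * H η ∂(surf d) := by
  have hmem : ∀ x ∈ Submodule.span ℝ (Set.range (Y l)), Continuous x := fun x hx =>
    continuous_of_mem_sphericalHarmonics (hY.span_eq l ▸ hx)
  rw [← hY.span_eq l] at hH
  induction hH using Submodule.span_induction with
  | mem x hx =>
    obtain ⟨k, rfl⟩ := hx
    exact h k
  | zero => simp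
  | add x z hx hz ihx ihz =>
    simp only [Pi.add_apply, mul_add]
    rw [integral_add (integrable_mul_continuous hF (hmem x hx))
        (integrable_mul_continuous hF (hmem z hz)),
      integral_add (integrable_mul_continuous hG (hmem x hx))
        (integrable_mul_continuous hG (hmem z hz)), ihx, ihz, mul_add]
  | smul a x hx ih =>
    have : ∀ K : S d → ℝ, ∫ η, K η * (a • x) η ∂(surf d) = a * ∫ η, K η * x η ∂(surf d) := by
      intro K
      rw [← integral_const_mul]
      exact integral_congr_ae (ae_of_all _ fun η => by simp; ring)
    rw [this, this, ih]
    ring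

lemma one_mem_sphericalHarmonics (d : ℕ) : (fun _ : S d => (1 : ℝ)) ∈ sphericalHarmonics d 0 := by
  have y : S d := ⟨EuclideanSpace.single 0 1, by simp⟩
  simpa [gegenbauer] using gegenbauer_mem_sphericalHarmonics d y 0

/-- Orthogonality of degrees `l` and `0`, extended from the basis to the whole spaces by using
`integral_mul_eq` twice with `G = 0`, the second time against the constant `1`. -/
lemma IsHarmonicBasis.integral_eq_zero (hY : IsHarmonicBasis d Y) {l : ℕ} (hl : l ≠ 0)
    {H : S d → ℝ} (hH : H ∈ sphericalHarmonics d l) : ∫ η, H η ∂(surf d) = 0 := by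
  have hHc := (continuous_of_mem_sphericalHarmonics hH).integrable_of_hasCompactSupport
    (μ := surf d) (HasCompactSupport.of_compactSpace _)
  have h0 : Integrable (fun _ : S d => (0 : ℝ)) (surf d) := integrable_zero _ _ _
  have h1 : ∀ k, ∫ η, H η * Y 0 k η ∂(surf d) = 0 := by
    intro k
    have hYk : Integrable (Y 0 k) (surf d) :=
      (hY.continuous 0 k).integrable_of_hasCompactSupport (HasCompactSupport.of_compactSpace _)
    have := hY.integral_mul_eq (c := 1) hYk h0 (l := l) (fun j => ?_) hH
    · simpa [mul_comm] using this
    · rw [hY.orthogonal 0 k l j (by simp [Ne.symm hl])]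
      simp
  have := hY.integral_mul_eq (c := 1) hHc h0 (l := 0) (fun k => by rw [h1]; simp)
    (one_mem_sphericalHarmonics d)
  simpa using this

/-- The total mass of the Poisson kernel. -/
lemma IsHarmonicBasis.integral_poisson (hY : IsHarmonicBasis d Y) (hd : 2 ≤ d) (y : S d) {s : ℝ}
    (h0 : 0 ≤ s) (h1 : s < 1) :
    (1 - s ^ 2) * ∫ η, 1 / ‖s • (η : E d) - y‖ ^ (d + 1) ∂(surf d) = area d := by
  have h := hasSum_integral_poisson y (by omega) h0 h1 (integrable_const (1 : ℝ))
  have h2 : HasSum (fun n : ℕ => (2 * (n : ℝ) + d - 1) * s ^ n *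
      ∫ η : S d, 1 * gegenbauer d (inner ℝ (η : E d) (y : E d)) n ∂(surf d))
      (((d : ℝ) - 1) * area d) := by
    -- Zonal harmonics of positive degree have mean zero, so only the constant term contributes.
    convert hasSum_single 0 fun n hn => ?_ using 1
    · simp [gegenbauer, surf_real_univ]
    · simp only [one_mul]
      rw [hY.integral_eq_zero hn (gegenbauer_mem_sphericalHarmonics d y n), mul_zero]
  have hd' : (d : ℝ) - 1 ≠ 0 := by
    have : (2 : ℝ) ≤ d := by exact_mod_cast hd
    linarith
  simpa using mul_left_cancel₀ hd' (h.unique h2)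

/-- If the coefficients of `F` are those of `G` times `(2l+d-1) / ((d-1) ω_d)`, then the Newtonian
potential of `F` is the Poisson integral of `G`. -/
lemma IsHarmonicBasis.integral_newton_eq_poisson (hY : IsHarmonicBasis d Y) (hd : 2 ≤ d) (y : S d)
    {s : ℝ} (h0 : 0 ≤ s) (h1 : s < 1) {F G : S d → ℝ} (hF : Integrable F (surf d))
    (hG : Integrable G (surf d))
    (h : ∀ l k, ∫ η, F η * Y l k η ∂(surf d) =
      (2 * (l : ℝ) + (d : ℝ) - 1) / (((d : ℝ) - 1) * area d) * ∫ η, G η * Y l k η ∂(surf d)) :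
    ∫ η, F η * (1 / ‖s • (η : E d) - y‖ ^ (d - 1)) ∂(surf d) =
      (1 - s ^ 2) / area d * ∫ η, G η * (1 / ‖s • (η : E d) - y‖ ^ (d + 1)) ∂(surf d) := by
  have hA := area_pos d
  have hd' : (d : ℝ) - 1 ≠ 0 := by
    have : (2 : ℝ) ≤ d := by exact_mod_cast hd
    linarith
  have hN := hasSum_integral_newton y (by omega) h0 h1 hF
  -- After division by `(d-1) ω_d`, the degree-`l` term of the Poisson series of `G` is exactly the
  -- degree-`l` term of the Newtonian series of `F`.
  have hP := (hasSum_integral_poisson y (by omega) h0 h1 hG).mul_left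
    (1 / (((d : ℝ) - 1) * area d))
  have := hN.unique (hP.congr_fun fun n => by
    rw [hY.integral_mul_eq hF hG (h n) (gegenbauer_mem_sphericalHarmonics d y n)]
    ring)
  rw [this]
  field_simp

end Basis

/-! ### Surface measure on the sphere of radius `r` -/

section Scaled

variable {d : ℕ} {r : ℝ}

lemma measurableEmbedding_smul (hr : 0 < r) :
    MeasurableEmbedding fun η : S d => r • (η : E d) := by
  have hc : Continuous fun η : S d => r • (η : E d) := by fun_prop
  refine (hc.isClosedEmbedding fun a b hab => ?_).measurableEmbedding
  exact Subtype.ext (smul_right_injective _ hr.ne' hab)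

lemma integrable_surfR_iff (hr : 0 < r) {g : E d → ℝ} :
    Integrable g (surfR d r) ↔ Integrable (fun η : S d => g (r • (η : E d))) (surf d) := by
  rw [surfR, integrable_smul_measure (by simp; positivity) ENNReal.ofReal_ne_top,
    (measurableEmbedding_smul hr).integrable_map_iff]
  rfl

lemma integral_surfR (hr : 0 < r) (g : E d → ℝ) :
    ∫ x, g x ∂(surfR d r) = r ^ d * ∫ η : S d, g (r • (η : E d)) ∂(surf d) := by
  rw [surfR, integral_smul_measure, (measurableEmbedding_smul hr).integral_map,
    ENNReal.toReal_ofReal (by positivity), smul_eq_mul]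

lemma ae_norm_eq_surfR (hr : 0 < r) : ∀ᵐ x ∂(surfR d r), ‖x‖ = r := by
  refine Measure.ae_smul_measure ?_ _
  rw [(measurableEmbedding_smul hr).ae_map_iff]
  exact ae_of_all _ fun η => by simp [norm_smul, abs_of_pos hr]

end Scaled

/-! ### A maximum principle for the exterior of a ball -/

/-- The function `W` is twice differentiable at `x` along the coordinate lines, and its second
derivatives add up to zero. -/
def LineHarmonicAt {d : ℕ} (W : E d → ℝ) (x : E d) : Prop :=
  ∃ D : Fin (d + 1) → ℝ, ∑ i, D i = 0 ∧ ∀ i, ∃ φ : ℝ → ℝ,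
    (∀ᶠ s in 𝓝 (0 : ℝ),
      HasDerivAt (fun s : ℝ => W (x + s • EuclideanSpace.single i (1 : ℝ))) (φ s) s) ∧
    HasDerivAt φ (D i) 0

section LineHarmonic

variable {d : ℕ} {W V : E d → ℝ} {x : E d}

lemma LineHarmonicAt.neg (h : LineHarmonicAt W x) : LineHarmonicAt (fun z => -W z) x := by
  obtain ⟨D, hD, h⟩ := h
  refine ⟨fun i => -D i, by simp [hD], fun i => ?_⟩
  obtain ⟨φ, h1, h2⟩ := h i
  exact ⟨fun s => -φ s, h1.mono fun s hs => hs.neg, h2.neg⟩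

lemma LineHarmonicAt.sub (h : LineHarmonicAt W x) (h' : LineHarmonicAt V x) :
    LineHarmonicAt (fun z => W z - V z) x := by
  obtain ⟨D, hD, h⟩ := h
  obtain ⟨D', hD', h'⟩ := h'
  refine ⟨fun i => D i - D' i, by simp [hD, hD'], fun i => ?_⟩
  obtain ⟨φ, h1, h2⟩ := h i
  obtain ⟨φ', h1', h2'⟩ := h' i
  exact ⟨fun s => φ s - φ' s, (h1.and h1').mono fun s hs => hs.1.sub hs.2, h2.sub h2'⟩

lemma tendsto_line (x e : E d) : Tendsto (fun s : ℝ => x + s • e) (𝓝 0) (𝓝 x) := by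
  have : Continuous fun s : ℝ => x + s • e := by fun_prop
  simpa using this.tendsto 0

lemma LineHarmonicAt.congr (h : LineHarmonicAt W x) (hWV : W =ᶠ[𝓝 x] V) :
    LineHarmonicAt V x := by
  obtain ⟨D, hD, h⟩ := h
  refine ⟨D, hD, fun i => ?_⟩
  obtain ⟨φ, h1, h2⟩ := h i
  refine ⟨φ, ?_, h2⟩
  have := (tendsto_line x (EuclideanSpace.single i (1 : ℝ))).eventually hWV
  filter_upwards [h1, this.eventually_nhds] with s hs hs'
  exact hs.congr_of_eventuallyEq (hs'.mono fun t ht => ht.symm)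

lemma hasDerivAt_line (x e : E d) (s : ℝ) : HasDerivAt (fun s : ℝ => x + s • e) e s := by
  simpa using ((hasDerivAt_id s).smul_const e).const_add x

/-- The maximum principle needs second derivatives along coordinate lines only. Passing to this
weaker notion means that the Poisson integral never has to be shown to be `C²`. -/
lemma _root_.InnerProductSpace.HarmonicAt.lineHarmonicAt
    (h : InnerProductSpace.HarmonicAt W x) : LineHarmonicAt W x := by
  obtain ⟨hc, hΔ⟩ := h
  have h0 := hΔ.eq_of_nhds
  rw [InnerProductSpace.laplacian_eq_iteratedFDeriv_orthonormalBasis W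
    (EuclideanSpace.basisFun (Fin (d + 1)) ℝ)] at h0
  refine ⟨fun i => fderiv ℝ (fderiv ℝ W) x (EuclideanSpace.single i 1)
    (EuclideanSpace.single i 1), ?_, fun i => ?_⟩
  · simpa [iteratedFDeriv_two_apply] using h0
  · set e : E d := EuclideanSpace.single i 1
    refine ⟨fun s => fderiv ℝ W (x + s • e) e, ?_, ?_⟩
    · have := (tendsto_line x e).eventually (hc.eventually (by simp))
      filter_upwards [this] with s hs
      exact (hs.differentiableAt (by norm_num)).hasFDerivAt.comp_hasDerivAt s
        (hasDerivAt_line x e s)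
    · have h1 : HasFDerivAt (fderiv ℝ W) (fderiv ℝ (fderiv ℝ W) x) (x + (0 : ℝ) • e) := by
        rw [zero_smul, add_zero]
        exact ((hc.fderiv_right (m := 1) (by norm_num)).differentiableAt
          (by norm_num)).hasFDerivAt
      have h2 := h1.comp_hasDerivAt (0 : ℝ) (hasDerivAt_line x e 0)
      simpa using h2.clm_apply (hasDerivAt_const (0 : ℝ) e)

/-- A strictly subharmonic perturbation of `W` has no local maximum. -/
lemma LineHarmonicAt.not_isLocalMax (h : LineHarmonicAt W x) {ε : ℝ} (hε : 0 < ε) :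
    ¬ IsLocalMax (fun z => W z + ε * ‖z‖ ^ 2) x := by
  intro hmax
  obtain ⟨D, hD, h⟩ := h
  -- The second derivatives of the perturbed function along the axes add up to `2ε(d+1) > 0`, so one
  -- of them is positive.
  obtain ⟨i, hi⟩ : ∃ i, 0 < D i + 2 * ε := by
    by_contra! hcon
    have := Finset.sum_le_sum fun i (_ : i ∈ Finset.univ) => hcon i
    rw [Finset.sum_add_distrib, hD] at this
    simp at this
    have h2 : 0 < ((d : ℝ) + 1) * (2 * ε) := by positivity
    linarith
  obtain ⟨φ, h1, h2⟩ := h i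
  set e : E d := EuclideanSpace.single i 1 with he
  have hn : ∀ s : ℝ, ‖x + s • e‖ ^ 2 = ‖x‖ ^ 2 + 2 * s * x i + s ^ 2 := by
    intro s
    rw [norm_add_sq_real, norm_smul, inner_smul_right]
    simp [he, EuclideanSpace.inner_single_right]
    ring
  set ψ : ℝ → ℝ := fun s => W (x + s • e) + ε * ‖x + s • e‖ ^ 2
  have hψ' : ∀ᶠ s in 𝓝 (0 : ℝ), HasDerivAt ψ (φ s + ε * (2 * x i + 2 * s)) s := by
    filter_upwards [h1] with s hs
    refine hs.add ?_
    simp only [hn]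
    have := ((((hasDerivAt_id s).const_mul 2).mul_const (x i)).const_add (‖x‖ ^ 2)).add
      ((hasDerivAt_id s).pow 2)
    exact (this.const_mul ε).congr_deriv (by simp)
  have hd1 : deriv ψ =ᶠ[𝓝 0] fun s => φ s + ε * (2 * x i + 2 * s) := hψ'.mono fun s hs => hs.deriv
  have hdd : deriv (deriv ψ) 0 = D i + 2 * ε := by
    rw [hd1.deriv_eq]
    have := h2.add (((((hasDerivAt_id (0 : ℝ)).const_mul 2).const_add (2 * x i))).const_mul ε)
    refine this.deriv.trans ?_
    ring
  have hlm : IsLocalMax ψ 0 := by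
    have h0 : x + (0 : ℝ) • e = x := by simp
    have := (tendsto_line x e).eventually hmax
    filter_upwards [this] with s hs
    simpa [ψ, h0] using hs
  -- The second derivative test makes the local maximum a local minimum too, so `ψ` is locally
  -- constant, against `ψ''(0) > 0`.
  have hlmin := isLocalMin_of_deriv_deriv_pos (by rw [hdd]; exact hi) hlm.deriv_eq_zero
    hψ'.self_of_nhds.continuousAt
  have hconst : ψ =ᶠ[𝓝 0] fun _ => ψ 0 := by
    filter_upwards [hlm, hlmin] with s hs hs' using le_antisymm hs hs'
  have : deriv (deriv ψ) 0 = 0 := by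
    have h3 : deriv ψ =ᶠ[𝓝 0] fun _ => 0 := by
      filter_upwards [hconst.eventually_nhds] with s hs
      rw [Filter.EventuallyEq.deriv_eq hs, deriv_const]
    rw [h3.deriv_eq, deriv_const]
  rw [hdd] at this
  linarith

/-- Maximum principle on the exterior of a ball. -/
theorem nonpos_of_lineHarmonicAt_exterior {r : ℝ} (hc : ContinuousOn W {x | r ≤ ‖x‖})
    (hb : ∀ x, ‖x‖ = r → W x ≤ 0) (hinf : ∀ m > 0, ∀ᶠ x in cocompact (E d), W x < m)
    (hW : ∀ x, r < ‖x‖ → LineHarmonicAt W x) {x : E d} (hx : r ≤ ‖x‖) : W x ≤ 0 := by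
  by_contra! hpos
  obtain ⟨R, hR⟩ : ∃ R, ∀ z : E d, R ≤ ‖z‖ → W z < W x / 2 := by
    have := hinf (W x / 2) (by linarith)
    rw [← Metric.cobounded_eq_cocompact, ← comap_norm_atTop, eventually_comap] at this
    obtain ⟨R, hR⟩ := eventually_atTop.1 this
    exact ⟨R, fun z hz => hR _ hz z rfl⟩
  set T := max R (max ‖x‖ 1)
  have hT : 0 < T := lt_of_lt_of_le one_pos ((le_max_right _ _).trans (le_max_right _ _))
  -- With this `ε` the perturbation is at most `W x / 4` on the ball of radius `T`, so a maximizer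
  -- `z` has `W z ≥ 3/4 * W x`. This excludes `‖z‖ = r`, where `W ≤ 0`, and `‖z‖ = T`, where `W < W
  -- x / 2`.
  set ε := W x / (4 * T ^ 2) with hεdef
  have hε : 0 < ε := by positivity
  have hεT : ε * T ^ 2 = W x / 4 := by
    rw [hεdef]; field_simp
  set K : Set (E d) := {z | r ≤ ‖z‖} ∩ closedBall 0 T
  have hK : IsCompact K :=
    (isCompact_closedBall 0 T).inter_left (isClosed_le continuous_const continuous_norm)
  have hxT : ‖x‖ ≤ T := (le_max_left _ _).trans (le_max_right _ _)
  have hxK : x ∈ K := ⟨hx, by simpa using hxT⟩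
  obtain ⟨z, hzK, hz⟩ := hK.exists_isMaxOn ⟨x, hxK⟩
    ((hc.mono Set.inter_subset_left).add (f := W) (g := fun z => ε * ‖z‖ ^ 2) (by fun_prop))
  have hzx : W x + ε * ‖x‖ ^ 2 ≤ W z + ε * ‖z‖ ^ 2 := hz hxK
  have hzT : ‖z‖ ≤ T := by simpa using hzK.2
  have hzε : ε * ‖z‖ ^ 2 ≤ W x / 4 := by
    rw [← hεT]
    gcongr
  have hx0 : 0 ≤ ε * ‖x‖ ^ 2 := by positivity
  have hz1 : r < ‖z‖ := by
    refine lt_of_le_of_ne hzK.1 fun heq => ?_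
    have := hb z heq.symm
    linarith
  have hz2 : ‖z‖ < T := by
    refine lt_of_le_of_ne hzT fun heq => ?_
    have := hR z (heq ▸ le_max_left _ _)
    linarith
  refine (hW z hz1).not_isLocalMax hε ?_
  refine IsMaxOn.isLocalMax hz (inter_mem ?_ ?_)
  · exact mem_of_superset ((isOpen_lt continuous_const continuous_norm).mem_nhds hz1)
      fun w (hw : r < ‖w‖) => hw.le
  · exact closedBall_mem_nhds_of_mem (by simpa using hz2)

end LineHarmonic

/-! ### Harmonicity of the exterior Poisson integral -/

/-- Joint continuity of `P'` on the compact set `[-δ, δ] × S^d` bounds it by a constant `C`, and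
`|g| C` is an integrable majorant. -/
lemma hasDerivAt_integral_mul_sphere {d : ℕ} {g : S d → ℝ} (hg : Integrable g (surf d))
    {P P' : ℝ → S d → ℝ} {δ : ℝ}
    (hP : ∀ s, |s| ≤ δ → Continuous (P s))
    (hP' : ContinuousOn (fun z : ℝ × S d => P' z.1 z.2) (Set.Icc (-δ) δ ×ˢ Set.univ))
    (hd : ∀ s, |s| ≤ δ → ∀ η, HasDerivAt (fun s => P s η) (P' s η) s) {s : ℝ} (hs : |s| < δ) :
    HasDerivAt (fun s => ∫ η, g η * P s η ∂(surf d)) (∫ η, g η * P' s η ∂(surf d)) s := by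
  have hcomp : IsCompact (Set.Icc (-δ) δ ×ˢ (Set.univ : Set (S d))) :=
    isCompact_Icc.prod isCompact_univ
  obtain ⟨C, hC⟩ := hcomp.exists_bound_of_continuousOn hP'
  have hmem : ∀ t ∈ Set.Ioo (-δ) δ, |t| ≤ δ := fun t ht => abs_le.2 ⟨ht.1.le, ht.2.le⟩
  have hsm : s ∈ Set.Ioo (-δ) δ := abs_lt.1 hs
  have hnhds : Set.Ioo (-δ) δ ∈ 𝓝 s := Ioo_mem_nhds hsm.1 hsm.2
  have hP's : Continuous (P' s) := by
    rw [← continuousOn_univ]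
    exact hP'.comp (f := fun η => (s, η)) (by fun_prop)
      fun η _ => ⟨⟨hsm.1.le, hsm.2.le⟩, trivial⟩
  refine (hasDerivAt_integral_of_dominated_loc_of_deriv_le (bound := fun η => |g η| * C)
    (F := fun s η => g η * P s η) (F' := fun s η => g η * P' s η) hnhds ?_ ?_ ?_ ?_ ?_ ?_).2
  · filter_upwards [hnhds] with t ht
    exact hg.aestronglyMeasurable.mul (hP t (hmem t ht)).aestronglyMeasurable
  · exact integrable_mul_continuous hg (hP s hs.le)
  · exact hg.aestronglyMeasurable.mul hP's.aestronglyMeasurable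
  · refine ae_of_all _ fun η t ht => ?_
    rw [norm_mul, Real.norm_eq_abs]
    exact mul_le_mul_of_nonneg_left (hC (t, η) ⟨⟨ht.1.le, ht.2.le⟩, trivial⟩) (abs_nonneg _)
  · exact hg.abs.mul_const _
  · exact ae_of_all _ fun η t ht => (hd t (hmem t ht) η).const_mul _

/-- First and second derivative of `N q^{-β}` for monic quadratic polynomials `N` and `q`. -/
lemma hasDerivAt_quadratic_mul_rpow {β : ℝ} {N₀ a q₀ b s : ℝ}
    (hq : q₀ + 2 * b * s + s ^ 2 ≠ 0) :
    HasDerivAt (fun s : ℝ => (N₀ + 2 * a * s + s ^ 2) * (q₀ + 2 * b * s + s ^ 2) ^ (-β))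
      ((2 * a + 2 * s) * (q₀ + 2 * b * s + s ^ 2) ^ (-β)
        - β * ((N₀ + 2 * a * s + s ^ 2) * (2 * b + 2 * s))
          * (q₀ + 2 * b * s + s ^ 2) ^ (-β - 1)) s ∧
    HasDerivAt (fun s : ℝ => (2 * a + 2 * s) * (q₀ + 2 * b * s + s ^ 2) ^ (-β)
        - β * ((N₀ + 2 * a * s + s ^ 2) * (2 * b + 2 * s)) * (q₀ + 2 * b * s + s ^ 2) ^ (-β - 1))
      (2 * (q₀ + 2 * b * s + s ^ 2) ^ (-β)
        - (2 * β * ((2 * a + 2 * s) * (2 * b + 2 * s)) + 2 * β * (N₀ + 2 * a * s + s ^ 2))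
          * (q₀ + 2 * b * s + s ^ 2) ^ (-β - 1)
        + β * (β + 1) * ((N₀ + 2 * a * s + s ^ 2) * (2 * b + 2 * s) ^ 2)
          * (q₀ + 2 * b * s + s ^ 2) ^ (-β - 1 - 1)) s := by
  have hquad : ∀ c e : ℝ, HasDerivAt (fun s : ℝ => c + 2 * e * s + s ^ 2) (2 * e + 2 * s) s := by
    intro c e
    have := (((hasDerivAt_id s).const_mul (2 * e)).const_add c).add ((hasDerivAt_id s).pow 2)
    exact this.congr_deriv (by simp)
  have hlin : ∀ e : ℝ, HasDerivAt (fun s : ℝ => 2 * e + 2 * s) 2 s := by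
    intro e
    exact (((hasDerivAt_id s).const_mul 2).const_add (2 * e)).congr_deriv (by simp)
  have hN := hquad N₀ a
  have hQ := hquad q₀ b
  have h1 := hQ.rpow_const (p := -β) (Or.inl hq)
  have h2 := hQ.rpow_const (p := -β - 1) (Or.inl hq)
  constructor
  · exact (hN.mul h1).congr_deriv (by ring)
  · exact (((hlin a).mul h1).sub (((hN.mul (hlin b)).const_mul β).mul h2)).congr_deriv (by simp only [Pi.mul_apply]; ring)

/-- The Poisson kernel of the exterior of the ball of radius `r`, up to a constant factor. -/
noncomputable def poissonKernel (d : ℕ) (r : ℝ) (x : E d) (η : S d) : ℝ :=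
  (‖x‖ ^ 2 - r ^ 2) * (1 / ‖x - r • (η : E d)‖ ^ (d + 1))

/-- The Poisson integral, for the exterior of the ball of radius `r`, of `g`. -/
noncomputable def poissonIntegral (d : ℕ) (r : ℝ) (g : S d → ℝ) (x : E d) : ℝ :=
  r ^ (d - 1) / area d * ∫ η, g η * poissonKernel d r x η ∂(surf d)

section Poisson

variable {d : ℕ} {r : ℝ} {x : E d}

lemma sub_le_norm_sub_smul (hr : 0 < r) (x : E d) (η : S d) :
    ‖x‖ - r ≤ ‖x - r • (η : E d)‖ := by
  have := norm_sub_norm_le x (r • (η : E d))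
  rwa [norm_smul, norm_eq_of_mem_sphere, mul_one, Real.norm_of_nonneg hr.le] at this

lemma norm_sub_smul_pos (hr : 0 < r) (hx : r < ‖x‖) (η : S d) : 0 < ‖x - r • (η : E d)‖ :=
  (sub_pos.2 hx).trans_le (sub_le_norm_sub_smul hr x η)

lemma poissonKernel_nonneg (hr : 0 < r) (hx : r < ‖x‖) (η : S d) : 0 ≤ poissonKernel d r x η := by
  have : 0 ≤ ‖x‖ ^ 2 - r ^ 2 := by
    rw [sub_nonneg]
    gcongr
  unfold poissonKernel
  positivity

lemma continuous_poissonKernel (hr : 0 < r) (hx : r < ‖x‖) :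
    Continuous (poissonKernel d r x) := by
  unfold poissonKernel
  have : ∀ η : S d, ‖x - r • (η : E d)‖ ^ (d + 1) ≠ 0 := fun η =>
    (pow_pos (norm_sub_smul_pos hr hx η) _).ne'
  fun_prop (disch := exact this _)

lemma poissonKernel_eq_rpow (x : E d) (η : S d) :
    poissonKernel d r x η = (‖x‖ ^ 2 - r ^ 2) *
      (‖x - r • (η : E d)‖ ^ 2) ^ (-(((d : ℝ) + 1) / 2)) := by
  have h : ∀ t : ℝ, 0 ≤ t → (t ^ 2) ^ (((d : ℝ) + 1) / 2) = t ^ (d + 1) := by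
    intro t ht
    rw [← Real.rpow_natCast t 2, ← Real.rpow_mul ht, ← Real.rpow_natCast]
    congr 1
    push_cast
    ring
  rw [poissonKernel, Real.rpow_neg (by positivity), h _ (norm_nonneg _), one_div]

lemma norm_add_smul_single_sq (z : E d) (i : Fin (d + 1)) (s : ℝ) :
    ‖z + s • EuclideanSpace.single i (1 : ℝ)‖ ^ 2 = ‖z‖ ^ 2 + 2 * z i * s + s ^ 2 := by
  rw [norm_add_sq_real, norm_smul, inner_smul_right]
  simp [EuclideanSpace.inner_single_right]
  ring

/-- Along a coordinate line both `‖x‖² - r²` and `‖x - rη‖²` are monic quadratics in the parameter,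
so the kernel is `N q^{-β}` with `β = (d+1)/2`, and its two derivatives are explicit and can be
taken under the integral. -/
lemma lineHarmonicAt_integral_poissonKernel (hr : 0 < r) (hx : r < ‖x‖) {g : S d → ℝ}
    (hg : Integrable g (surf d)) :
    LineHarmonicAt (fun x => ∫ η, g η * poissonKernel d r x η ∂(surf d)) x := by
  set β : ℝ := ((d : ℝ) + 1) / 2 with hβ
  obtain ⟨δ, hδ, hδx⟩ : ∃ δ, 0 < δ ∧ r < ‖x‖ - δ := ⟨(‖x‖ - r) / 2, by linarith, by linarith⟩
  set N₀ : ℝ := ‖x‖ ^ 2 - r ^ 2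
  set z : S d → E d := fun η => x - r • (η : E d) with hz
  have hzc : Continuous z := by fun_prop
  set q : Fin (d + 1) → ℝ → S d → ℝ := fun i s η => ‖z η‖ ^ 2 + 2 * z η i * s + s ^ 2 with hqdef
  have hqc : ∀ i, Continuous fun w : ℝ × S d => q i w.1 w.2 := by
    intro i
    fun_prop
  have hline : ∀ i (s : ℝ), |s| ≤ δ → r < ‖x + s • EuclideanSpace.single i (1 : ℝ)‖ := by
    intro i s hs
    have := norm_sub_le_norm_add x (s • EuclideanSpace.single i (1 : ℝ))
    rw [norm_smul] at this
    simp at this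
    linarith
  have hq : ∀ i s, |s| ≤ δ → ∀ η, q i s η ≠ 0 := by
    intro i s hs η
    have h1 := norm_sub_smul_pos hr (hline i s hs) η
    have h2 : x + s • EuclideanSpace.single i (1 : ℝ) - r • (η : E d) =
        z η + s • EuclideanSpace.single i (1 : ℝ) := by
      simp only [hz]; abel
    rw [h2] at h1
    rw [hqdef]
    simp only
    rw [← norm_add_smul_single_sq]
    positivity
  have hker : ∀ i (s : ℝ) η, poissonKernel d r (x + s • EuclideanSpace.single i (1 : ℝ)) η =
      (N₀ + 2 * x i * s + s ^ 2) * q i s η ^ (-β) := by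
    intro i s η
    have h2 : x + s • EuclideanSpace.single i (1 : ℝ) - r • (η : E d) =
        z η + s • EuclideanSpace.single i (1 : ℝ) := by
      simp only [hz]; abel
    rw [poissonKernel_eq_rpow, h2, norm_add_smul_single_sq, norm_add_smul_single_sq]
    congr 1
    simp only [N₀]
    ring
  set P₁ : Fin (d + 1) → ℝ → S d → ℝ := fun i s η => (2 * x i + 2 * s) * q i s η ^ (-β)
    - β * ((N₀ + 2 * x i * s + s ^ 2) * (2 * z η i + 2 * s)) * q i s η ^ (-β - 1) with hP1
  set P₂ : Fin (d + 1) → ℝ → S d → ℝ := fun i s η => 2 * q i s η ^ (-β)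
    - (2 * β * ((2 * x i + 2 * s) * (2 * z η i + 2 * s)) + 2 * β * (N₀ + 2 * x i * s + s ^ 2))
      * q i s η ^ (-β - 1)
    + β * (β + 1) * ((N₀ + 2 * x i * s + s ^ 2) * (2 * z η i + 2 * s) ^ 2)
      * q i s η ^ (-β - 1 - 1) with hP2
  have hqpow : ∀ i (p : ℝ), ContinuousOn (fun w : ℝ × S d => q i w.1 w.2 ^ p)
      (Set.Icc (-δ) δ ×ˢ Set.univ) := fun i p =>
    (hqc i).continuousOn.rpow_const fun w hw => Or.inl (hq i w.1 (abs_le.2 hw.1) w.2)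
  have hP1c : ∀ i, ContinuousOn (fun w : ℝ × S d => P₁ i w.1 w.2)
      (Set.Icc (-δ) δ ×ˢ Set.univ) := by
    intro i
    have h1 := hqpow i (-β)
    have h2 := hqpow i (-β - 1)
    have : Continuous fun w : ℝ × S d => z w.2 i := by fun_prop
    exact (ContinuousOn.mul (by fun_prop) h1).sub (ContinuousOn.mul (by fun_prop) h2)
  have hP2c : ∀ i, ContinuousOn (fun w : ℝ × S d => P₂ i w.1 w.2)
      (Set.Icc (-δ) δ ×ˢ Set.univ) := by
    intro i
    have h1 := hqpow i (-β)
    have h2 := hqpow i (-β - 1)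
    have h3 := hqpow i (-β - 1 - 1)
    have : Continuous fun w : ℝ × S d => z w.2 i := by fun_prop
    exact ((ContinuousOn.mul (by fun_prop) h1).sub (ContinuousOn.mul (by fun_prop) h2)).add
      (ContinuousOn.mul (by fun_prop) h3)
  have hslice : ∀ {P : ℝ → S d → ℝ}, ContinuousOn (fun w : ℝ × S d => P w.1 w.2)
      (Set.Icc (-δ) δ ×ˢ Set.univ) → ∀ s, |s| ≤ δ → Continuous (P s) := by
    intro P hP s hs
    rw [← continuousOn_univ]
    exact hP.comp (f := fun η => (s, η)) (by fun_prop) fun η _ => ⟨abs_le.1 hs, trivial⟩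
  have hδ0 : |(0 : ℝ)| < δ := by simpa using hδ
  refine ⟨fun i => ∫ η, g η * P₂ i 0 η ∂(surf d), ?_, fun i => ⟨fun s => ∫ η, g η * P₁ i s η ∂(surf d),
    ?_, ?_⟩⟩
  · rw [← integral_finsetSum _ fun i _ =>
      integrable_mul_continuous hg (hslice (hP2c i) 0 hδ0.le)]
    rw [integral_eq_zero_of_ae (ae_of_all _ fun η => ?_)]
    simp only [Pi.zero_apply]
    rw [← Finset.mul_sum]
    have hqz : ∀ i, q i 0 η = ‖z η‖ ^ 2 := by
      intro i; simp [hqdef]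
    have hQ : 0 < ‖z η‖ ^ 2 := by
      have := norm_sub_smul_pos hr hx η
      positivity
    set Q := ‖z η‖ ^ 2 with hQdef
    have hzz : ∑ i, z η i ^ 2 = Q := (EuclideanSpace.real_norm_sq_eq _).symm
    -- This is `‖x - z‖ = r` expanded. Together with `d + 1 = 2β` it makes the second derivatives
    -- cancel: their sum is a multiple of `Q + N₀ - 2⟪x, z⟫`.
    have hxz : 2 * ∑ i, x i * z η i = Q + N₀ := by
      have h1 : ∑ i, x i * z η i = inner ℝ x (z η) := by
        rw [PiLp.inner_apply]
        exact Finset.sum_congr rfl fun i _ => by simp [mul_comm]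
      have h2 : ‖x - z η‖ ^ 2 = r ^ 2 := by
        simp [hz, norm_smul]
      rw [norm_sub_sq_real] at h2
      rw [h1]
      simp only [N₀, hQdef]
      linarith
    have hsum : ∑ i, P₂ i 0 η = (2 * ((d : ℝ) + 1)) * Q ^ (-β)
        - (8 * β * ∑ i, x i * z η i + 2 * β * N₀ * ((d : ℝ) + 1)) * Q ^ (-β - 1)
        + 4 * β * (β + 1) * N₀ * (∑ i, z η i ^ 2) * Q ^ (-β - 1 - 1) := by
      have : ∀ i, P₂ i 0 η = 2 * Q ^ (-β) - 8 * β * Q ^ (-β - 1) * (x i * z η i)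
          - 2 * β * N₀ * Q ^ (-β - 1) + 4 * β * (β + 1) * N₀ * Q ^ (-β - 1 - 1) * z η i ^ 2 := by
        intro i
        simp only [hP2, hqz]
        ring
      simp only [this, Finset.sum_add_distrib, Finset.sum_sub_distrib, ← Finset.mul_sum,
        Finset.sum_const, Finset.card_univ, Fintype.card_fin, nsmul_eq_mul]
      push_cast
      ring
    have hp1 : Q ^ (-β) = Q ^ (-β - 1 - 1) * Q ^ 2 := by
      rw [← Real.rpow_natCast Q 2, ← Real.rpow_add hQ]; congr 1; push_cast; ring
    have hp2 : Q ^ (-β - 1) = Q ^ (-β - 1 - 1) * Q := by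
      rw [← Real.rpow_add_one hQ.ne']; congr 1; ring
    have hdβ : (d : ℝ) + 1 = 2 * β := by rw [hβ]; ring
    rw [hsum, hzz, hdβ, hp1, hp2]
    linear_combination (-(g η) * 4 * β * Q ^ (-β - 1 - 1) * Q) * hxz
  · have : ∀ᶠ s in 𝓝 (0 : ℝ), |s| < δ := (continuous_abs.tendsto 0).eventually_lt_const hδ0
    filter_upwards [this] with s hs
    simp only [hker]
    refine hasDerivAt_integral_mul_sphere hg (δ := δ) ?_ (hP1c i) ?_ hs
    · refine hslice (ContinuousOn.mul (by fun_prop) (hqpow i (-β)))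
    · exact fun s hs η => (hasDerivAt_quadratic_mul_rpow (hq i s hs η)).1
  · exact hasDerivAt_integral_mul_sphere hg (δ := δ) (hslice (hP1c i)) (hP2c i)
      (fun s hs η => (hasDerivAt_quadratic_mul_rpow (hq i s hs η)).2) hδ0

end Poisson

/-! ### Boundary values, decay and uniqueness -/

section PoissonIntegral

variable {d : ℕ} {r : ℝ} {x : E d}

/-- Rescaling to the unit sphere, with `s = r/ρ`, brings the exterior kernel to the form whose
series and mass are known. -/
lemma poissonKernel_smul (hd : 1 ≤ d) {ρ : ℝ} (hρ : 0 < ρ) (y η : S d) :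
    poissonKernel d r (ρ • (y : E d)) η =
      (1 - (r / ρ) ^ 2) / ρ ^ (d - 1) * (1 / ‖(r / ρ) • (η : E d) - y‖ ^ (d + 1)) := by
  have h : ‖ρ • (y : E d) - r • (η : E d)‖ = ρ * ‖(r / ρ) • (η : E d) - y‖ := by
    have : ρ • (y : E d) - r • (η : E d) = (-ρ) • ((r / ρ) • (η : E d) - y) := by
      rw [smul_sub, smul_smul, neg_mul, mul_div_cancel₀ _ hρ.ne', neg_smul, neg_smul]
      abel
    rw [this, norm_smul, norm_neg, Real.norm_of_nonneg hρ.le]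
  rw [poissonKernel, h, norm_smul, norm_eq_of_mem_sphere, Real.norm_of_nonneg hρ.le, mul_one,
    mul_pow, div_pow]
  have hpow : ρ ^ (d + 1) = ρ ^ (d - 1) * ρ ^ 2 := by rw [← pow_add]; congr 1; omega
  rw [hpow, one_div, one_div, mul_inv]
  field_simp

/-- The mass of the Poisson kernel at an exterior point. -/
lemma IsHarmonicBasis.integral_poissonKernel {Y : (l : ℕ) → Fin (Z d l) → S d → ℝ}
    (hY : IsHarmonicBasis d Y) (hd : 2 ≤ d) (hr : 0 < r) (hx : r < ‖x‖) :
    ∫ η, r ^ (d - 1) / area d * poissonKernel d r x η ∂(surf d) = (r / ‖x‖) ^ (d - 1) := by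
  have hρ : 0 < ‖x‖ := hr.trans hx
  set y : S d := ⟨‖x‖⁻¹ • x, by simp [norm_smul, hρ.ne']⟩ with hy
  have hxy : ‖x‖ • (y : E d) = x := by simp [hy, smul_smul, hρ.ne']
  have hA := area_pos d
  have hm := hY.integral_poisson hd y (s := r / ‖x‖) (by positivity) ((div_lt_one hρ).2 hx)
  have h1 : ∀ η, poissonKernel d r x η = _ := fun η => by
    rw [← hxy, poissonKernel_smul (by omega) hρ y η]
  simp only [h1]
  rw [integral_const_mul, integral_const_mul, div_mul_eq_mul_div _ (‖x‖ ^ (d - 1)), hm, div_pow]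
  field_simp

lemma continuousAt_poissonIntegral (hr : 0 < r) (hx : r < ‖x‖) {g : S d → ℝ}
    (hg : Integrable g (surf d)) : ContinuousAt (poissonIntegral d r g) x := by
  obtain ⟨δ, hδ, hδx⟩ : ∃ δ, 0 < δ ∧ r + δ < ‖x‖ := ⟨(‖x‖ - r) / 2, by linarith, by linarith⟩
  -- Near `x` one has `‖z‖ < ‖x‖ + 1` and `‖z - rη‖ > δ`, which gives the majorant.
  refine ContinuousAt.mul continuousAt_const (continuousAt_of_dominated
    (bound := fun η => |g η| * ((‖x‖ + 1) ^ 2 * (1 / δ ^ (d + 1)))) ?_ ?_ (hg.abs.mul_const _) ?_)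
  · filter_upwards [continuous_norm.continuousAt.eventually_const_lt hx] with z hz
    exact hg.aestronglyMeasurable.mul (continuous_poissonKernel hr hz).aestronglyMeasurable
  · filter_upwards [continuous_norm.continuousAt.eventually_const_lt hδx,
      continuous_norm.continuousAt.eventually_lt_const (lt_add_one ‖x‖)] with z hz hz'
    refine ae_of_all _ fun η => ?_
    have hrz : r < ‖z‖ := by linarith
    have hz0 : 0 ≤ ‖z‖ := norm_nonneg z
    rw [norm_mul, Real.norm_eq_abs]
    refine mul_le_mul_of_nonneg_left ?_ (abs_nonneg _)
    rw [Real.norm_of_nonneg (poissonKernel_nonneg hr hrz η), poissonKernel]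
    have h1 := sub_le_norm_sub_smul hr z η
    gcongr
    · nlinarith [sq_nonneg r]
    · linarith
  · refine ae_of_all _ fun η => ContinuousAt.mul continuousAt_const ?_
    unfold poissonKernel
    have : ‖x - r • (η : E d)‖ ^ (d + 1) ≠ 0 := (pow_pos (norm_sub_smul_pos hr hx η) _).ne'
    fun_prop (disch := exact this)

/-- The kernel is positive with mass `(r/‖x‖)^(d-1)`. As `d ≥ 2`, this supplies the decay at
infinity. -/
lemma IsHarmonicBasis.abs_poissonIntegral_le {Y : (l : ℕ) → Fin (Z d l) → S d → ℝ}
    (hY : IsHarmonicBasis d Y) (hd : 2 ≤ d) (hr : 0 < r) (hx : r < ‖x‖) {g : S d → ℝ} {M : ℝ}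
    (hM : ∀ η, |g η| ≤ M) : |poissonIntegral d r g x| ≤ M * (r / ‖x‖) ^ (d - 1) := by
  have hA := area_pos d
  rw [← hY.integral_poissonKernel hd hr hx, ← integral_const_mul, poissonIntegral,
    ← integral_const_mul, ← Real.norm_eq_abs]
  refine norm_integral_le_of_norm_le ?_ (ae_of_all _ fun η => ?_)
  · exact (((continuous_poissonKernel hr hx).const_mul _).const_mul _).integrable_of_hasCompactSupport
      (HasCompactSupport.of_compactSpace _)
  · have h1 := poissonKernel_nonneg hr hx η
    rw [norm_mul, norm_mul, Real.norm_of_nonneg h1, Real.norm_of_nonneg (by positivity),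
      Real.norm_eq_abs]
    have h2 : 0 ≤ r ^ (d - 1) / area d * poissonKernel d r x η := by positivity
    nlinarith [hM η]

/-- The kernel is an approximate identity: it is nonnegative, its mass `(r/‖x‖)^(d-1)` tends to `1`
at the boundary, and it tends to zero uniformly away from `η₀`. -/
lemma IsHarmonicBasis.tendsto_poissonIntegral {Y : (l : ℕ) → Fin (Z d l) → S d → ℝ}
    (hY : IsHarmonicBasis d Y) (hd : 2 ≤ d) (hr : 0 < r) {g : S d → ℝ}
    (hg : Continuous g) (η₀ : S d) :
    Tendsto (poissonIntegral d r g) (𝓝[{x | r < ‖x‖}] (r • (η₀ : E d))) (𝓝 (g η₀)) := by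
  have hA := area_pos d
  set x₀ : E d := r • (η₀ : E d) with hx₀
  have hx₀n : ‖x₀‖ = r := by simp [hx₀, norm_smul, abs_of_pos hr]
  set φ : E d → S d → ℝ := fun x η => r ^ (d - 1) / area d * poissonKernel d r x η with hφ
  have hev : ∀ᶠ x in 𝓝[{x | r < ‖x‖}] x₀, r < ‖x‖ := self_mem_nhdsWithin
  have hpeak := tendsto_integral_peak_smul_of_integrable_of_tendsto (μ := surf d) (φ := φ)
    (l := 𝓝[{x | r < ‖x‖}] x₀) (x₀ := η₀) (g := g) (a := g η₀) MeasurableSet.univ univ_mem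
    (measure_ne_top _ _) ?_ ?_ ?_ ?_
    (hg.integrable_of_hasCompactSupport (HasCompactSupport.of_compactSpace _)) (hg.tendsto η₀)
  · refine hpeak.congr fun x => ?_
    rw [poissonIntegral, ← integral_const_mul]
    exact integral_congr_ae (ae_of_all _ fun η => by simp [hφ]; ring)
  · filter_upwards [hev] with x hx η
    have := poissonKernel_nonneg hr hx η
    positivity
  · intro u hu hη₀
    obtain ⟨δ, hδ, hδu⟩ := Metric.isOpen_iff.1 hu η₀ hη₀
    rw [tendstoUniformlyOn_iff]
    intro ε hε
    have hlim : Tendsto (fun x : E d => r ^ (d - 1) / area d *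
        ((‖x‖ ^ 2 - r ^ 2) * (1 / (r * δ / 2) ^ (d + 1)))) (𝓝[{x | r < ‖x‖}] x₀) (𝓝 0) := by
      have hc : Continuous fun x : E d => r ^ (d - 1) / area d *
        ((‖x‖ ^ 2 - r ^ 2) * (1 / (r * δ / 2) ^ (d + 1))) := by fun_prop
      have := hc.tendsto x₀
      rw [hx₀n] at this
      simp only [sub_self, zero_mul, mul_zero] at this
      exact this.mono_left nhdsWithin_le_nhds
    -- If `η` is at least `δ` from `η₀` and `x` is within `rδ/2` of `x₀`, then `‖x - rη‖ ≥ rδ/2`.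
    have hball : ∀ᶠ x in 𝓝[{x | r < ‖x‖}] x₀, x ∈ ball x₀ (r * δ / 2) :=
      nhdsWithin_le_nhds (ball_mem_nhds _ (by positivity))
    filter_upwards [hev, hball, hlim.eventually_lt_const hε] with x hx hxb hxε η hη
    have h1 := poissonKernel_nonneg hr hx η
    rw [Pi.zero_apply, dist_zero_left, Real.norm_of_nonneg (by positivity)]
    refine lt_of_le_of_lt ?_ hxε
    have hdist : δ ≤ ‖(η : E d) - η₀‖ := by
      by_contra! hlt
      exact hη (hδu (by rwa [mem_ball, Subtype.dist_eq, dist_eq_norm]))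
    have hfar : r * δ / 2 ≤ ‖x - r • (η : E d)‖ := by
      rw [mem_ball, dist_eq_norm] at hxb
      have h3 : ‖r • (η : E d) - x₀‖ = r * ‖(η : E d) - η₀‖ := by
        rw [hx₀, ← smul_sub, norm_smul, Real.norm_of_nonneg hr.le]
      have h4 : ‖r • (η : E d) - x₀‖ ≤ ‖x - r • (η : E d)‖ + ‖x - x₀‖ := by
        rw [norm_sub_rev x (r • (η : E d))]
        exact norm_sub_le_norm_sub_add_norm_sub _ _ _
      have h5 : r * δ ≤ r * ‖(η : E d) - η₀‖ := by gcongr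
      linarith
    have h6 : 0 ≤ ‖x‖ ^ 2 - r ^ 2 := by
      rw [sub_nonneg]
      gcongr
    simp only [hφ, poissonKernel]
    gcongr
  · simp only [setIntegral_univ, hφ]
    have h1 : Tendsto (fun x : E d => (r / ‖x‖) ^ (d - 1)) (𝓝[{x | r < ‖x‖}] x₀) (𝓝 1) := by
      have : ContinuousAt (fun x : E d => (r / ‖x‖) ^ (d - 1)) x₀ := by
        have : ‖x₀‖ ≠ 0 := by rw [hx₀n]; exact hr.ne'
        fun_prop (disch := exact this)
      have := this.tendsto
      rw [hx₀n, div_self hr.ne', one_pow] at this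
      exact this.mono_left nhdsWithin_le_nhds
    refine h1.congr' ?_
    filter_upwards [hev] with x hx
    exact (hY.integral_poissonKernel hd hr hx).symm
  · filter_upwards [hev] with x hx
    exact ((continuous_poissonKernel hr hx).const_mul _).aestronglyMeasurable

lemma lineHarmonicAt_poissonIntegral (hr : 0 < r) (hx : r < ‖x‖) {g : S d → ℝ}
    (hg : Integrable g (surf d)) : LineHarmonicAt (poissonIntegral d r g) x := by
  obtain ⟨D, hD, h⟩ := lineHarmonicAt_integral_poissonKernel hr hx hg
  refine ⟨fun i => r ^ (d - 1) / area d * D i, by rw [← Finset.mul_sum, hD, mul_zero],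
    fun i => ?_⟩
  obtain ⟨φ, h1, h2⟩ := h i
  exact ⟨fun s => r ^ (d - 1) / area d * φ s, h1.mono fun s hs => hs.const_mul _,
    h2.const_mul _⟩

/-- A function that is harmonic outside a ball, continuous up to the boundary and zero at infinity
is the Poisson integral of its boundary values. -/
theorem IsHarmonicBasis.eq_poissonIntegral {Y : (l : ℕ) → Fin (Z d l) → S d → ℝ}
    (hY : IsHarmonicBasis d Y) (hd : 2 ≤ d) (hr : 0 < r) {f : E d → ℝ}
    (hf : InnerProductSpace.HarmonicOnNhd f {x | r < ‖x‖}) (hc : ContinuousOn f {x | r ≤ ‖x‖})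
    (h0 : Tendsto f (cocompact (E d)) (𝓝 0)) (hx : r < ‖x‖) :
    f x = poissonIntegral d r (fun η => f (r • (η : E d))) x := by
  set g : S d → ℝ := fun η => f (r • (η : E d)) with hgdef
  have hg : Continuous g := by
    rw [← continuousOn_univ]
    refine hc.comp (f := fun η : S d => r • (η : E d)) (by fun_prop) fun η _ => ?_
    simp [norm_smul, abs_of_pos hr]
  have hgi : Integrable g (surf d) :=
    hg.integrable_of_hasCompactSupport (HasCompactSupport.of_compactSpace _)
  obtain ⟨M, hM⟩ := isCompact_univ.exists_bound_of_continuousOn hg.continuousOn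
  set v := poissonIntegral d r g
  set U : Set (E d) := {x | r < ‖x‖}
  have hU : IsOpen U := isOpen_lt continuous_const continuous_norm
  -- The difference is extended by zero because `v` itself does not take the boundary values on the
  -- sphere, where the factor `‖x‖² - r²` vanishes. The maximum principle is then applied to `W` and
  -- `-W`.
  set W : E d → ℝ := U.indicator fun x => f x - v x with hWdef
  have hWU : ∀ z ∈ U, W =ᶠ[𝓝 z] fun x => f x - v x := fun z hz => by
    filter_upwards [hU.mem_nhds hz] with w hw using Set.indicator_of_mem hw _
  have hWb : ∀ z, ‖z‖ = r → W z = 0 := fun z hz =>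
    Set.indicator_of_notMem (by simp [U, hz]) _
  have hWc : ContinuousOn W {x | r ≤ ‖x‖} := by
    intro z hz
    rcases (show r ≤ ‖z‖ from hz).lt_or_eq with hlt | heq
    · refine ContinuousAt.continuousWithinAt ?_
      refine ContinuousAt.congr ?_ (hWU z hlt).symm
      exact (hf z hlt).1.continuousAt.sub (continuousAt_poissonIntegral hr hlt hgi)
    · set η₀ : S d := ⟨r⁻¹ • z, by simp [norm_smul, ← heq, hr.ne', abs_of_pos hr]⟩ with hη₀
      have hzη : r • (η₀ : E d) = z := by simp [hη₀, smul_smul, hr.ne']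
      have h1 := hY.tendsto_poissonIntegral hd hr hg η₀
      rw [hzη] at h1
      have h2 : Tendsto f (𝓝[U] z) (𝓝 (f z)) :=
        (hc z hz).mono_left (nhdsWithin_mono _ fun w (hw : r < ‖w‖) => hw.le)
      have h3 : Tendsto (fun x => f x - v x) (𝓝[U] z) (𝓝 0) := by
        have := h2.sub h1
        simpa [hgdef, hzη] using this
      have h4 : Tendsto W (𝓝 z) (𝓝 0) := by
        rw [← nhdsWithin_univ, ← Set.union_compl_self U, nhdsWithin_union]
        refine Tendsto.sup (h3.congr' ?_) (Tendsto.congr' (f₁ := fun _ => (0 : ℝ)) ?_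
          tendsto_const_nhds)
        · filter_upwards [self_mem_nhdsWithin] with w hw
          exact (hWU w hw).self_of_nhds.symm
        · filter_upwards [self_mem_nhdsWithin] with w hw
          rw [hWdef, Set.indicator_of_notMem hw]
      rw [ContinuousWithinAt, hWb z heq.symm]
      exact h4.mono_left nhdsWithin_le_nhds
  have hvinf : Tendsto (U.indicator v) (cocompact (E d)) (𝓝 0) := by
    have hn : Tendsto (fun x : E d => ‖x‖) (cocompact (E d)) atTop := tendsto_norm_cocompact_atTop
    have h1 : Tendsto (fun x : E d => M * (r / ‖x‖) ^ (d - 1)) (cocompact (E d)) (𝓝 0) := by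
      have := ((tendsto_const_nhds (x := r)).div_atTop hn).pow (d - 1)
      rw [zero_pow (by omega : d - 1 ≠ 0)] at this
      simpa using this.const_mul M
    refine squeeze_zero_norm' ?_ h1
    filter_upwards [hn.eventually_gt_atTop r] with z hz
    rw [Set.indicator_of_mem (show z ∈ U from hz), Real.norm_eq_abs]
    exact hY.abs_poissonIntegral_le hd hr hz fun η => hM η trivial
  have hWinf : Tendsto W (cocompact (E d)) (𝓝 0) := by
    have := h0.sub hvinf
    rw [sub_zero] at this
    refine this.congr' ?_
    have hn : Tendsto (fun x : E d => ‖x‖) (cocompact (E d)) atTop := tendsto_norm_cocompact_atTop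
    filter_upwards [hn.eventually_gt_atTop r] with z hz
    rw [hWdef, Set.indicator_of_mem (show z ∈ U from hz), Set.indicator_of_mem (show z ∈ U from hz)]
  have hWh : ∀ z, r < ‖z‖ → LineHarmonicAt W z := fun z hz =>
    (((hf z hz).lineHarmonicAt.sub (lineHarmonicAt_poissonIntegral hr hz hgi))).congr
      (hWU z hz).symm
  have hle := nonpos_of_lineHarmonicAt_exterior hWc (fun z hz => (hWb z hz).le)
    (fun m hm => hWinf.eventually_lt_const hm) hWh hx.le
  have hge := nonpos_of_lineHarmonicAt_exterior hWc.neg (fun z hz => by simp [hWb z hz])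
    (fun m hm => by
      have := hWinf.neg
      rw [neg_zero] at this
      exact this.eventually_lt_const hm) (fun z hz => (hWh z hz).neg) hx.le
  have hWx : W x = f x - v x := Set.indicator_of_mem (show x ∈ U from hx) _
  simp only [Pi.neg_apply] at hge
  linarith

end PoissonIntegral

/-! ### Potential representation and the error bound -/

section Quadrature

variable {d : ℕ} {r : ℝ}

lemma isFiniteMeasure_surfR (d : ℕ) (r : ℝ) : IsFiniteMeasure (surfR d r) := by
  unfold surfR
  exact Measure.smul_finite _ ENNReal.ofReal_ne_top

/-- A function of the class `𝓕_r` is, on the unit sphere, `1/r` times the Newtonian potential of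
`D(f)`. -/
theorem MemF.eq_integral_surfR {Y : (l : ℕ) → Fin (Z d l) → S d → ℝ} (hY : IsHarmonicBasis d Y)
    (hd : 2 ≤ d) (hr0 : 0 < r) (hr1 : r < 1) {f Df : E d → ℝ} (hf : MemF Y r f)
    (hDf : IsD Y r f Df) {y : E d} (hy : y ∈ sphere (0 : E d) 1) :
    f y = 1 / r * ∫ x, Df x * (1 / ‖x - y‖ ^ (d - 1)) ∂(surfR d r) := by
  have hy1 : ‖y‖ = 1 := by simpa using hy
  have hg : Continuous fun η : S d => f (r • (η : E d)) := by
    rw [← continuousOn_univ]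
    refine hf.continuousOn.comp (f := fun η : S d => r • (η : E d)) (by fun_prop) fun η _ => ?_
    simp [norm_smul, abs_of_pos hr0]
  have hgi : Integrable (fun η : S d => f (r • (η : E d))) (surf d) :=
    hg.integrable_of_hasCompactSupport (HasCompactSupport.of_compactSpace _)
  have h1 := hY.integral_newton_eq_poisson hd ⟨y, hy⟩ hr0.le hr1
    ((integrable_surfR_iff hr0).1 hDf.integrable) hgi hDf.coeff_eq
  rw [integral_surfR hr0, h1, hY.eq_poissonIntegral hd hr0 hf.harmonic hf.continuousOn hf.vanishes
    (by rw [hy1]; exact hr1), poissonIntegral]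
  have h2 : ∀ η : S d, f (r • (η : E d)) * poissonKernel d r y η =
      (1 - r ^ 2) * (f (r • (η : E d)) * (1 / ‖r • (η : E d) - y‖ ^ (d + 1))) := by
    intro η
    rw [poissonKernel, hy1, norm_sub_rev]
    ring
  simp only [h2]
  rw [integral_const_mul]
  -- Surface measure on the sphere of radius `r` scales by `r^d` while the Poisson integral carries
  -- `r^(d-1)`; this is the source of the factor `1/r`.
  have hrd : r ^ d = r ^ (d - 1) * r := by rw [← pow_succ]; congr 1; omega
  rw [hrd]
  field_simp

/-- Integration over the unit sphere against `μ - ν`, for a finite measure `μ` and a weighted point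
measure `ν`. -/
lemma integral_toSignedMeasure_sub_pointMeasure {n : ℕ} (a : Fin n → ℝ) (t : Fin n → S d)
    (μ : Measure (E d)) [IsFiniteMeasure μ] {F : E d → ℝ}
    (hF : Integrable F (μ.restrict (sphere (0 : E d) 1))) :
    (∫ᵛ y in sphere (0 : E d) 1, F y ∂<•(μ.toSignedMeasure - pointMeasure a t)) =
      (∫ y in sphere (0 : E d) 1, F y ∂μ) - ∑ k, a k * F (t k) := by
  have hs : MeasurableSet (sphere (0 : E d) 1) := isClosed_sphere.measurableSet
  have hdir : ∀ k, (Measure.dirac (t k : E d)).restrict (sphere (0 : E d) 1) =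
      Measure.dirac (t k : E d) := by
    intro k
    classical
    rw [MeasureTheory.restrict_dirac' hs, if_pos (t k).2]
  -- Restriction to the sphere does not change the point masses, as every `t k` lies on it.
  have hres : (μ.toSignedMeasure - pointMeasure a t).restrict (sphere (0 : E d) 1) =
      (μ.restrict (sphere (0 : E d) 1)).toSignedMeasure - pointMeasure a t := by
    ext B hB
    have h1 := Measure.toSignedMeasure_restrict_eq_restrict_toSignedMeasure μ
      (sphere (0 : E d) 1) hs
    have h2 : ∀ k, (Measure.dirac (t k : E d)).toSignedMeasure (B ∩ sphere (0 : E d) 1) =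
        (Measure.dirac (t k : E d)).toSignedMeasure B := by
      intro k
      rw [← VectorMeasure.restrict_apply _ hs hB,
        Measure.toSignedMeasure_restrict_eq_restrict_toSignedMeasure _ _ hs]
      simp only [hdir]
    rw [← h1, VectorMeasure.restrict_apply _ hs hB, sub_apply,
      sub_apply, VectorMeasure.restrict_apply _ hs hB]
    simp [pointMeasure, h2]
  have hint : ∀ k, (a k • (Measure.dirac (t k : E d)).toSignedMeasure).Integrable F := by
    intro k
    refine VectorMeasure.Integrable.smul_vectorMeasure ?_ _
    rw [VectorMeasure.Integrable, Measure.variation_toSignedMeasure]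
    exact integrable_dirac (by simp)
  rw [hres, VectorMeasure.integral_sub_vectorMeasure, VectorMeasure.integral_toSignedMeasure,
    pointMeasure, VectorMeasure.integral_finsetSum_vectorMeasure fun k _ => hint k]
  · congr 1
    refine Finset.sum_congr rfl fun k _ => ?_
    rw [VectorMeasure.integral_smul_vectorMeasure, VectorMeasure.integral_toSignedMeasure,
      integral_dirac, smul_eq_mul]
  · rwa [VectorMeasure.Integrable, Measure.variation_toSignedMeasure]
  · exact VectorMeasure.Integrable.finsetSum_vectorMeasure fun k _ => hint k

/-- The two spheres are at distance `1 - r`, so the kernel between them is bounded; every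
integrability claim for Fubini rests on this. -/
lemma newton_le {x y : E d} (hr1 : r < 1) (hx : ‖x‖ = r) (hy : ‖y‖ = 1) (m : ℕ) :
    ‖1 / ‖x - y‖ ^ m‖ ≤ 1 / (1 - r) ^ m := by
  have h1 : 1 - r ≤ ‖x - y‖ := by
    have := norm_sub_norm_le y x
    rwa [hx, hy, norm_sub_rev] at this
  have h2 : 0 < 1 - r := by linarith
  rw [Real.norm_of_nonneg (by positivity)]
  gcongr

end Quadrature

end SphereQuadrature

open SphereQuadrature in
theorem corollary3 (d : ℕ) (hd : 2 ≤ d)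
    (Y : (l : ℕ) → Fin (Z d l) → S d → ℝ) (hY : IsHarmonicBasis d Y)
    (r₀ r : ℝ) (hr₀ : 0 < r₀) (hr₀r : r₀ < r) (hr : r < 1)
    (f : E d → ℝ) (hf : MemF Y r f) (hsum : IsSumOfExpansion Y r f)
    (Df : E d → ℝ) (hDf : IsD Y r f Df)
    (n : ℕ) (hn : 1 ≤ n) (t : Fin n → S d) (ht : Function.Injective t) (a : Fin n → ℝ)
    (μ : Measure (E d)) [IsFiniteMeasure μ] (hμ : μ (sphere (0 : E d) 1)ᶜ = 0)
    (p p' : ℝ≥0∞) (hp : 1 ≤ p) (hp' : 1 ≤ p') (hpp' : 1 / p + 1 / p' = 1) :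
    ENNReal.ofReal |(∫ x in sphere (0 : E d) 1, f x ∂μ) - ∑ k, a k * f (t k)| ≤
      ENNReal.ofReal (1 / r₀) * eLpNorm Df p (surfR d r) *
        eLpNorm (potential (μ.toSignedMeasure - pointMeasure a t)) p' (surfR d r) := by
  have hr0 : 0 < r := hr₀.trans hr₀r
  have := isFiniteMeasure_surfR d r
  set ν := μ.restrict (sphere (0 : E d) 1)
  set K : E d → E d → ℝ := fun x y => 1 / ‖x - y‖ ^ (d - 1) with hK
  have hKm : Measurable (Function.uncurry K) := by
    simp only [hK, Function.uncurry_def]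
    fun_prop
  have hνs : ∀ᵐ y ∂ν, y ∈ sphere (0 : E d) 1 := ae_restrict_mem isClosed_sphere.measurableSet
  have hrs := ae_norm_eq_surfR (d := d) hr0
  have hKν : ∀ x, ‖x‖ = r → Integrable (K x) ν := fun x hx => by
    refine Integrable.of_bound (hKm.comp measurable_prodMk_left).aestronglyMeasurable
      (1 / (1 - r) ^ (d - 1)) ?_
    filter_upwards [hνs] with y hy
    exact newton_le hr hx (by simpa using hy) _
  have hKr : ∀ y ∈ sphere (0 : E d) 1, Integrable (fun x => Df x * K x y) (surfR d r) := by
    intro y hy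
    refine hDf.integrable.mul_bdd (c := 1 / (1 - r) ^ (d - 1))
      (hKm.comp measurable_prodMk_right).aestronglyMeasurable ?_
    filter_upwards [hrs] with x hx
    exact newton_le hr hx (by simpa using hy) _
  have hprod : Integrable (Function.uncurry fun x y => Df x * K x y) ((surfR d r).prod ν) := by
    refine (hDf.integrable.comp_fst ν).mul_bdd (c := 1 / (1 - r) ^ (d - 1))
      hKm.aestronglyMeasurable ?_
    filter_upwards [Measure.quasiMeasurePreserving_fst.ae hrs,
      Measure.quasiMeasurePreserving_snd.ae hνs] with z hz1 hz2
    exact newton_le hr hz1 (by simpa using hz2) _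
  -- An explicit, visibly measurable version of the potential, equal to it on the sphere of radius
  -- `r`.
  set U : E d → ℝ := fun x => (∫ y, K x y ∂ν) - ∑ k, a k * K x (t k) with hU
  have hUm : StronglyMeasurable U := by
    refine hKm.stronglyMeasurable.integral_prod_right.sub ?_
    refine Measurable.stronglyMeasurable ?_
    exact Finset.measurable_sum _ fun k _ => (hKm.comp measurable_prodMk_right).const_mul _
  have hpot : potential (μ.toSignedMeasure - pointMeasure a t) =ᵐ[surfR d r] U := by
    filter_upwards [hrs] with x hx
    exact integral_toSignedMeasure_sub_pointMeasure a t μ (hKν x hx)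
  have hrep : (∫ x in sphere (0 : E d) 1, f x ∂μ) - ∑ k, a k * f (t k) =
      1 / r * ∫ x, Df x * U x ∂(surfR d r) := by
    -- The potential representation of `f` is inserted under the integral and the order of
    -- integration exchanged.
    have h1 : ∫ x in sphere (0 : E d) 1, f x ∂μ =
        1 / r * ∫ x, ∫ y, Df x * K x y ∂ν ∂(surfR d r) := by
      rw [integral_integral_swap hprod, ← integral_const_mul]
      refine integral_congr_ae ?_
      filter_upwards [hνs] with y hy
      exact hf.eq_integral_surfR hY hd hr0 hr hDf hy
    have h2 : ∀ k, a k * f (t k) = 1 / r * ∫ x, a k * (Df x * K x (t k)) ∂(surfR d r) := by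
      intro k
      rw [hf.eq_integral_surfR hY hd hr0 hr hDf (t k).2, integral_const_mul]
      ring
    simp only [h1, h2]
    rw [← Finset.mul_sum, ← mul_sub, ← integral_finsetSum _ fun k _ => (hKr _ (t k).2).const_mul _,
      ← integral_sub (f := fun x => ∫ y, Df x * K x y ∂ν) hprod.integral_prod_left
        (integrable_finsetSum _ fun k _ => (hKr _ (t k).2).const_mul _)]
    congr 1
    refine integral_congr_ae (ae_of_all _ fun x => ?_)
    simp only [hU]
    rw [integral_const_mul, mul_sub, Finset.mul_sum]
    congr 1
    exact Finset.sum_congr rfl fun k _ => by ring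
  have hH : ENNReal.HolderTriple p p' 1 := ⟨by simpa [one_div] using hpp'⟩
  have hholder := eLpNorm_smul_le_mul_eLpNorm (r := 1) (hpqr := hH)
    hUm.aestronglyMeasurable hDf.integrable.aestronglyMeasurable
  rw [hrep, abs_mul, ENNReal.ofReal_mul (abs_nonneg _), eLpNorm_congr_ae hpot, mul_assoc]
  refine mul_le_mul' (ENNReal.ofReal_le_ofReal ?_) (le_trans ?_ hholder)
  -- The exact constant is `1/r`; here it is enlarged to `1/r₀`.
  · rw [abs_of_pos (by positivity)]
    gcongr
  · rw [eLpNorm_one_eq_lintegral_enorm, ← Real.norm_eq_abs, ofReal_norm]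
    exact enorm_integral_le_lintegral_enorm _
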